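/- An energy game is given by a finite directed graph $G=(V,E)$ with $n=|V|\ge 1$ nodes and $m=|E|$ edges in which every node has out-degree at least one, a partition $V=V_A\sqcup V_B$ of the nodes between Alice and Bob, and integer edge weights $w:E\to\mathbb Z$. A strategy $\sigma$ of Alice (respectively $\tau$ of Bob) maps each node of $V_A$ (respectively $V_B$) to one of its out-neighbours; a pair $(\sigma,\tau)$ leaves a subgraph $G(\sigma,\tau)$ in which every node has exactly one out-edge. Let $C$ be the unique cycle reachable from $s$ in $G(\sigma,\tau)$. Put $e^*_{G(\sigma,\tau),w}(s)=\infty$ if $w(C)<0$, and $e^*_{G(\sigma,\tau),w}(s)=\max\{0,-\min_P w(P)\}$ otherwise, where $P$ ranges over the simple paths in $G(\sigma,\tau)$ starting at $s$. The minimal energy of $s$ is $e^*_{G,w}(s)=\min_\sigma\max_\tau e^*_{G(\sigma,\tau),w}(s)$. A strategy $\tau^*$ of Bob is optimal for $s$ if $e^*_{G(\sigma,\tau^*),w}(s)\ge e^*_{G,w}(s)$ for every $\sigma$. The node $s$ has penalty at least $D\ge 0$ if Bob has a strategy $\tau^*$, optimal for $s$, such that for every $\sigma$ the cycle $C$ reachable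 from $s$ in $G(\sigma,\tau^*)$ satisfies: if $w(C)<0$, then $w(C)/|C|\le -D$. Let $P_{G,w}(s)\in[0,\infty]$ be the supremum of all such $D$, and $P(G,w)=\min_s P_{G,w}(s)$. Theorem. There is an algorithm that, given a weighted graph $(G,w)$ with $P(G,w)\ge 1$, an integer $M\ge 0$ such that $e^*_{G,w}(v)\le M$ for every node $v$ with $e^*_{G,w}(v)<\infty$, and an integer $c$ with $n\le c\le n\,P(G,w)$, computes a function $e:V\to\mathbb Z_{\ge 0}\cup\{\infty\}$ such that $$e(v)\le e^*_{G,w}(v)\le e(v)+c\qquad\text{for every node } v,$$ in time $O\bigl(m\cdot\max\{1,nM/c\}\bigr)$, that is, in time $O(mnM/c)$ whenever $nM\ge c$. The function computed is the minimal energy function $e=e^*_{G,w_B}$ of the rounded weights $w_B(u,v)=\lceil w(u,v)/B\rceil\cdot B$, where $B=\lfloor c/n\rfloor$. Time is counted on a unit-cost random-access machine whose words hold integers of absolute value at most polynomial in $n+M+c+W$, where $W=\max_{(u,v)\in E}|w(u,v)|$. -/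

import Mathlib

open scoped ENNReal NNReal

noncomputable section

/-! ### Energy games -/

/-- A game graph: a directed graph in which every node has out-degree at least one, together with
the set of nodes controlled by Alice (all other nodes are controlled by Bob). -/
structure GameGraph (V : Type*) where
  Adj : V → V → Prop
  alice : Set V
  exists_adj : ∀ u, ∃ v, Adj u v

namespace GameGraph

variable {V : Type*} (G : GameGraph V)

/-- The edges of the graph. -/
abbrev Edge : Type _ := {p : V × V // G.Adj p.1 p.2}

/-- A positional strategy of Alice: every node of hers is mapped to one of its out-neighbours. -/
abbrev AliceStrategy : Type _ := (u : {u : V // u ∈ G.alice}) → {v : V // G.Adj u v}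

/-- A positional strategy of Bob. -/
abbrev BobStrategy : Type _ := (u : {u : V // u ∉ G.alice}) → {v : V // G.Adj u v}

open Classical in
/-- `G(σ, τ)`, the subgraph given by a pair of strategies, as its successor function: the unique
out-edge of `u` in it is `(u, G.next σ τ u)`. -/
def next (σ : G.AliceStrategy) (τ : G.BobStrategy) (u : V) : V :=
  if h : u ∈ G.alice then (σ ⟨u, h⟩ : V) else (τ ⟨u, h⟩ : V)

/-- In the graph with edges `(u, f u)`, the total weight `w(P_i)` of the path `P_i` of length `i`
that starts in `s`. -/
def pathWeight (w : V → V → ℤ) (f : V → V) (s : V) (i : ℕ) : ℤ :=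
  ∑ j ∈ Finset.range i, w (f^[j] s) (f^[j + 1] s)

/-- The path `P_i` of length `i` that starts in `s` is simple: its `i + 1` nodes are distinct. -/
def IsSimplePath (f : V → V) (s : V) (i : ℕ) : Prop :=
  Set.InjOn (fun j => f^[j] s) (Set.Iic i)

section Finite

variable [Fintype V]

/-- A node of the unique cycle reachable from `s` in the graph with edges `(u, f u)`: after `|V|`
moves the car is on that cycle. -/
def cycleNode (f : V → V) (s : V) : V := f^[Fintype.card V] s

/-- The number of edges of the unique cycle reachable from `s`. -/
def cycleLength (f : V → V) (s : V) : ℕ := Function.minimalPeriod f (cycleNode f s)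

/-- The total weight of the unique cycle reachable from `s`. -/
def cycleWeight (w : V → V → ℤ) (f : V → V) (s : V) : ℤ :=
  pathWeight w f (cycleNode f s) (cycleLength f s)

open Classical in
/-- The minimal sufficient energy at `s` in the graph with edges `(u, f u)`: it is `∞` if the
reachable cycle has negative weight, and `max {0, - min w(P)}`, over all simple paths `P` starting
in `s`, otherwise. -/
def fixedEnergy (w : V → V → ℤ) (f : V → V) (s : V) : ℕ∞ :=
  if cycleWeight w f s < 0 then ⊤
  else ⨆ (i : ℕ) (_ : IsSimplePath f s i), (((-pathWeight w f s i).toNat : ℕ) : ℕ∞)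

/-- The minimal sufficient energy `e*(s) = min_σ max_τ e*_{G(σ, τ)}(s)`. -/
def minEnergy (w : V → V → ℤ) (s : V) : ℕ∞ :=
  ⨅ σ : G.AliceStrategy, ⨆ τ : G.BobStrategy, fixedEnergy w (G.next σ τ) s

/-- `τ` is an optimal strategy of Bob for the game that starts in `s`. -/
def IsBobOptimal (w : V → V → ℤ) (τ : G.BobStrategy) (s : V) : Prop :=
  ∀ σ : G.AliceStrategy, G.minEnergy w s ≤ fixedEnergy w (G.next σ τ) s

/-- The node `s` has a penalty of at least `D`. -/
def HasPenaltyAtLeast (w : V → V → ℤ) (s : V) (D : ℝ≥0) : Prop :=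
  ∃ τ : G.BobStrategy, G.IsBobOptimal w τ s ∧ ∀ σ : G.AliceStrategy,
    cycleWeight w (G.next σ τ) s < 0 →
      (cycleWeight w (G.next σ τ) s : ℝ) / (cycleLength (G.next σ τ) s : ℝ) ≤ -(D : ℝ)

/-- The penalty of a node, in `[0, ∞]`. -/
def nodePenalty (w : V → V → ℤ) (s : V) : ℝ≥0∞ :=
  ⨆ (D : ℝ≥0) (_ : G.HasPenaltyAtLeast w s D), (D : ℝ≥0∞)

/-- The penalty of the weighted graph: the minimum over its nodes. -/
def penalty (w : V → V → ℤ) : ℝ≥0∞ := ⨅ s, G.nodePenalty w s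

/-- `M` is an upper bound on the finite minimal energies. -/
def IsFiniteEnergyBound (w : V → V → ℤ) (M : ℕ) : Prop :=
  ∀ v, G.minEnergy w v ≠ ⊤ → G.minEnergy w v ≤ (M : ℕ∞)

end Finite

/-- The weights `w_B`: every weight is rounded up to the nearest multiple of `B`. -/
def roundUp (B : ℕ) (w : V → V → ℤ) (u v : V) : ℤ := ⌈(w u v : ℚ) / (B : ℚ)⌉ * (B : ℤ)

end GameGraph

/-! ### A random-access machine with unit cost and words of bounded size -/

namespace RAM

/-- The memory: integer registers, and arrays of integers with random access. The registers and
arrays that a program uses are named in the program, so there is a fixed number of them. -/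
structure Store where
  reg : ℕ → ℤ
  arr : ℕ → ℤ → ℤ

def Store.setReg (s : Store) (i : ℕ) (x : ℤ) : Store :=
  { s with reg := Function.update s.reg i x }

def Store.setArr (s : Store) (a : ℕ) (i x : ℤ) : Store :=
  { s with arr := Function.update s.arr a (Function.update (s.arr a) i x) }

/-- The operations on words; comparisons give `1` or `0`. -/
inductive Op
  | add | sub | mul | div | lt | eq

def Op.eval : Op → ℤ → ℤ → ℤ
  | .add, x, y => x + y
  | .sub, x, y => x - y
  | .mul, x, y => x * y
  | .div, x, y => x / y
  | .lt, x, y => if x < y then 1 else 0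
  | .eq, x, y => if x = y then 1 else 0

/-- Expressions: constants, registers, array cells and operations. -/
inductive Expr
  | const (x : ℤ)
  | reg (i : ℕ)
  | get (a : ℕ) (e : Expr)
  | op (o : Op) (e₁ e₂ : Expr)

def Expr.eval (s : Store) : Expr → ℤ
  | .const x => x
  | .reg i => s.reg i
  | .get a e => s.arr a (e.eval s)
  | .op o e₁ e₂ => o.eval (e₁.eval s) (e₂.eval s)

/-- The time for evaluating an expression: one step for every access and every operation. -/
def Expr.cost : Expr → ℕ
  | .const _ => 1
  | .reg _ => 1
  | .get _ e => e.cost + 1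
  | .op _ e₁ e₂ => e₁.cost + e₂.cost + 1

/-- All values that occur in the evaluation (addresses included) have absolute value at most `N`. -/
def Expr.Fits (N : ℕ) (s : Store) : Expr → Prop
  | .const x => |x| ≤ (N : ℤ)
  | .reg i => |s.reg i| ≤ (N : ℤ)
  | .get a e => e.Fits N s ∧ |s.arr a (e.eval s)| ≤ (N : ℤ)
  | .op o e₁ e₂ => e₁.Fits N s ∧ e₂.Fits N s ∧ |o.eval (e₁.eval s) (e₂.eval s)| ≤ (N : ℤ)

/-- Programs. A condition is true if its value is not `0`. -/
inductive Program
  | skip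
  | assign (i : ℕ) (e : Expr)
  | write (a : ℕ) (idx e : Expr)
  | seq (p q : Program)
  | cond (e : Expr) (p q : Program)
  | loop (e : Expr) (p : Program)

/-- `Runs N p s t s'`: started in `s`, the program `p` halts after exactly `t` steps in `s'`, and
all words that it handles have absolute value at most `N`. -/
inductive Runs (N : ℕ) : Program → Store → ℕ → Store → Prop
  | skip (s : Store) : Runs N .skip s 1 s
  | assign (i : ℕ) (e : Expr) (s : Store) (h : e.Fits N s) :
      Runs N (.assign i e) s (e.cost + 1) (s.setReg i (e.eval s))
  | write (a : ℕ) (idx e : Expr) (s : Store) (hi : idx.Fits N s) (h : e.Fits N s) :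
      Runs N (.write a idx e) s (idx.cost + e.cost + 1) (s.setArr a (idx.eval s) (e.eval s))
  | seq {p q : Program} {s s₁ s₂ : Store} {t₁ t₂ : ℕ} (hp : Runs N p s t₁ s₁)
      (hq : Runs N q s₁ t₂ s₂) : Runs N (.seq p q) s (t₁ + t₂) s₂
  | cond_true {e : Expr} {p q : Program} {s s' : Store} {t : ℕ} (h : e.Fits N s)
      (he : e.eval s ≠ 0) (hp : Runs N p s t s') : Runs N (.cond e p q) s (e.cost + 1 + t) s'
  | cond_false {e : Expr} {p q : Program} {s s' : Store} {t : ℕ} (h : e.Fits N s)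
      (he : e.eval s = 0) (hq : Runs N q s t s') : Runs N (.cond e p q) s (e.cost + 1 + t) s'
  | loop_true {e : Expr} {p : Program} {s s₁ s₂ : Store} {t₁ t₂ : ℕ} (h : e.Fits N s)
      (he : e.eval s ≠ 0) (hp : Runs N p s t₁ s₁) (hl : Runs N (.loop e p) s₁ t₂ s₂) :
      Runs N (.loop e p) s (e.cost + 1 + t₁ + t₂) s₂
  | loop_false {e : Expr} {p : Program} {s : Store} (h : e.Fits N s) (he : e.eval s = 0) :
      Runs N (.loop e p) s (e.cost + 1) s

/-- The array with the entries `f 0, …, f (k - 1)`, and `0` in all other cells. -/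
def ofFin {k : ℕ} (f : Fin k → ℤ) (i : ℤ) : ℤ :=
  if h : 0 ≤ i ∧ i < (k : ℤ) then f ⟨i.toNat, by omega⟩ else 0

open Classical in
/-- The input: registers `0, 1, 2, 3` hold `n, m, M, c`; array `0` holds the sources, array `1` the
targets and array `2` the weights of the `m` edges, in the order of the given list of edges;
array `3` holds `1` for the nodes of Alice and `0` for those of Bob. Everything else is `0`. -/
def inputStore {n m : ℕ} (G : GameGraph (Fin n)) (w : Fin n → Fin n → ℤ) (edges : Fin m ≃ G.Edge)
    (M c : ℕ) : Store where
  reg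
    | 0 => (n : ℤ)
    | 1 => (m : ℤ)
    | 2 => (M : ℤ)
    | 3 => (c : ℤ)
    | _ => 0
  arr
    | 0 => ofFin fun k : Fin m => ((edges k).1.1.val : ℤ)
    | 1 => ofFin fun k : Fin m => ((edges k).1.2.val : ℤ)
    | 2 => ofFin fun k : Fin m => w (edges k).1.1 (edges k).1.2
    | 3 => ofFin fun v : Fin n => if v ∈ G.alice then 1 else 0
    | _ => fun _ => 0

/-- An element of `ℕ ∪ {∞}` as a word; `∞` is `-1`. -/
def encode : ℕ∞ → ℤ
  | none => -1
  | some k => (k : ℤ)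

/-- The output: cell `v` of array `4` holds `e(v)`. -/
def Outputs {n : ℕ} (s : Store) (e : Fin n → ℕ∞) : Prop :=
  ∀ v : Fin n, s.arr 4 (v.val : ℤ) = encode (e v)

/-- The largest absolute value of the weight of an edge. -/
def maxWeight {n m : ℕ} (G : GameGraph (Fin n)) (w : Fin n → Fin n → ℤ)
    (edges : Fin m ≃ G.Edge) : ℕ :=
  Finset.univ.sup fun k : Fin m => (w (edges k).1.1 (edges k).1.2).natAbs

end RAM

end

noncomputable section

namespace GameGraph

variable {V : Type*} (G : GameGraph V)

/-! ### Paths in a functional graph -/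

/-! Accuracy. Rounding up only helps Alice, so the rounded energies are at most the original ones.
For the converse let Bob play a strategy `τ` that is optimal for `w` and has penalty `D > B - 1`,
against a strategy of Alice that is optimal for the rounded weights. Every edge gains at most `B -
1`. A simple path has fewer than `n` edges, so it gains at most `n * B ≤ c`. A negative cycle has
mean at most `-D < -(B - 1)`, so it stays negative; hence no infinite energy becomes finite. Such a
`D` exists because `B ≤ c / n` is at most the penalty. This is `minEnergy_le_roundUp_add`.

Algorithm. An energy `E` suffices in `s` iff some strategy of Alice keeps every walk of Bob,
positional or not, at weight at least `-E` (`minEnergy_le_iff`). Rounded weights are multiples of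
`B`, so in units of `B` the finite energies lie in `0, …, M / B`, and `M / B + 1` can stand for `∞`.
Starting from zero, a node that lacks good edges is lifted by one unit. Lifting preserves being a
lower bound for all sufficient energies (`IsLowerBound.lift`), and once no node can be lifted the
measure is the minimal energy (`Arena.minEnergy_eq`).

Time. After a lift only the edges at the lifted node are checked again, at constant cost each,
because `slack` counts the good out-edges (`slack_update`). A node is lifted at most `M / B + 1`
times and the degrees sum to `2 * m`, so the potential in `halts_mainLoop` gives `O(m (M / B + 1))`
steps, and `B ≥ c / (2 n)` turns this into the claimed bound (`time_le`). -/

theorem pathWeight_add (w : V → V → ℤ) (f : V → V) (s : V) (i j : ℕ) :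
    pathWeight w f s (i + j) = pathWeight w f s i + pathWeight w f (f^[i] s) j := by
  unfold pathWeight
  rw [Finset.sum_range_add]
  congr 1
  refine Finset.sum_congr rfl fun x _ => ?_
  rw [← Function.iterate_add_apply, ← Function.iterate_add_apply, add_comm i x,
    add_right_comm x i 1]

theorem pathWeight_iterate_of_periodic (w : V → V → ℤ) {f : V → V} {y : V} {p : ℕ}
    (h : f^[p] y = y) (r : ℕ) : pathWeight w f (f^[r] y) p = pathWeight w f y p := by
  have h₁ := pathWeight_add w f y r p
  have h₂ := pathWeight_add w f y p r
  rw [add_comm p r, h] at h₂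
  linarith

theorem pathWeight_mul_of_periodic (w : V → V → ℤ) {f : V → V} {y : V} {p : ℕ}
    (h : f^[p] y = y) (t : ℕ) : pathWeight w f y (t * p) = t * pathWeight w f y p := by
  induction t with
  | zero => simp [pathWeight]
  | succ t ih =>
    rw [add_mul, one_mul, add_comm, pathWeight_add, h, ih]
    push_cast
    ring

section Cycle

variable [Fintype V]

theorem cycleNode_mem_periodicPts (f : V → V) (s : V) :
    cycleNode f s ∈ Function.periodicPts f := by
  obtain ⟨a, b, hab, h⟩ := Fintype.exists_ne_map_eq_of_card_lt
    (fun i : Fin (Fintype.card V + 1) => f^[i] s) (by simp)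
  wlog hlt : a < b generalizing a b
  · exact this b a hab.symm h.symm (lt_of_le_of_ne (not_lt.mp hlt) hab.symm)
  have ha : f^[a] s ∈ Function.periodicPts f := by
    refine ⟨b - a, by simp only [gt_iff_lt]; omega, ?_⟩
    change f^[b - a] (f^[a] s) = f^[a] s
    rw [← Function.iterate_add_apply, Nat.sub_add_cancel hlt.le]
    exact h.symm
  have hn : cycleNode f s = f^[Fintype.card V - a] (f^[a] s) := by
    rw [← Function.iterate_add_apply, cycleNode, Nat.sub_add_cancel (by omega)]
  obtain ⟨q, hq, hp⟩ := ha
  rw [hn]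
  exact ⟨q, hq, hp.apply_iterate _⟩

theorem cycleLength_pos (f : V → V) (s : V) : 0 < cycleLength f s :=
  Function.minimalPeriod_pos_of_mem_periodicPts (cycleNode_mem_periodicPts f s)

theorem iterate_cycleLength (f : V → V) (s : V) :
    f^[cycleLength f s] (cycleNode f s) = cycleNode f s :=
  Function.iterate_minimalPeriod

/-- A closed walk in a functional graph runs round the only reachable cycle a whole number of times,
so `cycleWeight` decides its sign. Since `cycleNode` lies `card V` steps after `s`, the closed walk
is shifted by that many steps to compare the two. -/
theorem exists_pathWeight_eq_mul_cycleWeight (w : V → V → ℤ) (f : V → V) (s : V) {a q : ℕ}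
    (h : f^[a + q] s = f^[a] s) :
    ∃ t : ℕ, pathWeight w f (f^[a] s) q = t * cycleWeight w f s := by
  have hy : f^[q] (f^[a] s) = f^[a] s := by
    rw [← Function.iterate_add_apply, add_comm, h]
  have hz : f^[Fintype.card V] (f^[a] s) = f^[a] (cycleNode f s) := by
    rw [cycleNode, ← Function.iterate_add_apply, ← Function.iterate_add_apply, add_comm]
  have hper : Function.IsPeriodicPt f q (f^[a] (cycleNode f s)) := by
    rw [← hz]
    exact Function.IsPeriodicPt.apply_iterate hy _
  have hmin : Function.minimalPeriod f (f^[a] (cycleNode f s)) = cycleLength f s :=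
    Function.minimalPeriod_apply_iterate (cycleNode_mem_periodicPts f s) a
  obtain ⟨t, ht⟩ := hper.minimalPeriod_dvd
  rw [hmin] at ht
  refine ⟨t, ?_⟩
  rw [← pathWeight_iterate_of_periodic w hy (Fintype.card V), hz, ht, mul_comm,
    pathWeight_mul_of_periodic, pathWeight_iterate_of_periodic w (iterate_cycleLength f s),
    cycleWeight]
  rw [← hmin]
  exact Function.iterate_minimalPeriod

end Cycle

/-! ### Walks against a fixed strategy of Alice -/

/-- The moves that are possible when Alice plays `σ`. -/
def Move (σ : G.AliceStrategy) (u v : V) : Prop :=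
  G.Adj u v ∧ ∀ h : u ∈ G.alice, (σ ⟨u, h⟩ : V) = v

/-- The weight of the first `k` steps of a sequence of nodes. -/
def walkWeight (w : V → V → ℤ) (x : ℕ → V) (k : ℕ) : ℤ :=
  ∑ j ∈ Finset.range k, w (x j) (x (j + 1))

/-- Energy `E` suffices in `s` for Alice's strategy `σ` against all walks of Bob. -/
def Safe (σ : G.AliceStrategy) (w : V → V → ℤ) (s : V) (E : ℤ) : Prop :=
  ∀ (x : ℕ → V) (k : ℕ), x 0 = s → (∀ i < k, G.Move σ (x i) (x (i + 1))) →
    -E ≤ walkWeight w x k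

variable {G}

theorem move_next (σ : G.AliceStrategy) (τ : G.BobStrategy) (u : V) :
    G.Move σ u (G.next σ τ u) := by
  unfold Move next
  by_cases h : u ∈ G.alice
  · simpa [h] using (σ ⟨u, h⟩).2
  · simpa [h] using (τ ⟨u, h⟩).2

instance : Nonempty G.AliceStrategy :=
  ⟨fun u => ⟨(G.exists_adj u).choose, (G.exists_adj u).choose_spec⟩⟩

/-- Each of the nodes `x 0, …, x (k - 1)` is left only once, so a positional strategy can imitate
the walk. The last node `x k` may be an old one: this also realizes a path that closes a cycle. -/
theorem exists_next_eq_of_injOn (σ : G.AliceStrategy) {x : ℕ → V} {k : ℕ}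
    (hx : ∀ i < k, G.Move σ (x i) (x (i + 1))) (hinj : Set.InjOn x (Set.Iio k)) :
    ∃ τ : G.BobStrategy, ∀ i < k, G.next σ τ (x i) = x (i + 1) := by
  classical
  let τ : G.BobStrategy := fun u =>
    if h : ∃ i, i < k ∧ x i = u then
      ⟨x (h.choose + 1), by
        have := (hx _ h.choose_spec.1).1
        rwa [h.choose_spec.2] at this⟩
    else ⟨(G.exists_adj u).choose, (G.exists_adj u).choose_spec⟩
  refine ⟨τ, fun i hi => ?_⟩
  by_cases ha : x i ∈ G.alice
  · simp only [next, ha, dite_true]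
    exact (hx i hi).2 ha
  · have h : ∃ j, j < k ∧ x j = x i := ⟨i, hi, rfl⟩
    have hj : h.choose = i := hinj h.choose_spec.1 hi h.choose_spec.2
    simp only [next, ha, dite_false, τ, h, dite_true]
    rw [hj]

theorem iterate_eq_of_step {f : V → V} {x : ℕ → V} {k : ℕ}
    (h : ∀ i < k, f (x i) = x (i + 1)) {i : ℕ} (hi : i ≤ k) : f^[i] (x 0) = x i := by
  induction i with
  | zero => rfl
  | succ i ih => rw [Function.iterate_succ_apply', ih (by omega), h i (by omega)]

theorem Safe.nonneg {σ : G.AliceStrategy} {w : V → V → ℤ} {s : V} {E : ℤ}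
    (h : G.Safe σ w s E) : 0 ≤ E := by
  have := h (fun _ => s) 0 rfl (by simp)
  simp [walkWeight] at this
  exact this

theorem Safe.step {σ : G.AliceStrategy} {w : V → V → ℤ} {u v : V} {E : ℤ}
    (h : G.Safe σ w u E) (huv : G.Move σ u v) : G.Safe σ w v (E + w u v) := by
  intro x k hx0 hx
  -- The walk from `v` is prefixed with the node `u`.
  have := h (fun i => Nat.casesOn i u x) (k + 1) rfl (by
    rintro (_ | i) hi
    · simpa [hx0] using huv
    · exact hx i (by omega))
  rw [walkWeight, Finset.sum_range_succ'] at this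
  change _ ≤ walkWeight w x k + w u (x 0) at this
  rw [hx0] at this
  linarith

theorem Safe.mono_weight {σ : G.AliceStrategy} {w w' : V → V → ℤ} (hw : ∀ u v, w u v ≤ w' u v)
    {s : V} {E : ℤ} (h : G.Safe σ w s E) : G.Safe σ w' s E := fun x k hx0 hx =>
  (h x k hx0 hx).trans (Finset.sum_le_sum fun _ _ => hw _ _)

/-- If all weights are multiples of `B`, then so is the least sufficient energy. -/
theorem Safe.of_lt_mul_succ {σ : G.AliceStrategy} {w a : V → V → ℤ} {B : ℤ} (hB : 0 < B)
    (hw : ∀ u v, w u v = a u v * B) {s : V} {E k : ℤ} (h : G.Safe σ w s E)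
    (hE : E < (k + 1) * B) : G.Safe σ w s (k * B) := by
  intro x l hx0 hx
  have h₁ := h x l hx0 hx
  have h₂ : walkWeight w x l = walkWeight a x l * B := by
    simp [walkWeight, hw, Finset.sum_mul]
  rw [h₂] at h₁ ⊢
  -- In units of `B` the weight is an integer, so exceeding `-(k + 1)` means being at least `-k`.
  have : -(k + 1) < walkWeight a x l := by
    by_contra! hc
    nlinarith
  nlinarith

/-- A function that satisfies the energy inequalities locally bounds the sufficient energy. -/
theorem exists_safe_of_local (w : V → V → ℤ) (S : Set V) (g : V → ℤ) (hg : ∀ v, 0 ≤ g v)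
    (ha : ∀ v ∈ S, v ∈ G.alice → ∃ u, G.Adj v u ∧ u ∈ S ∧ g u ≤ g v + w v u)
    (hb : ∀ v ∈ S, v ∉ G.alice → ∀ u, G.Adj v u → u ∈ S ∧ g u ≤ g v + w v u) :
    ∃ σ : G.AliceStrategy, ∀ s ∈ S, G.Safe σ w s (g s) := by
  classical
  let σ : G.AliceStrategy := fun v =>
    if h : (v : V) ∈ S then ⟨(ha v h v.2).choose, (ha v h v.2).choose_spec.1⟩
    else ⟨(G.exists_adj v).choose, (G.exists_adj v).choose_spec⟩
  have hmove : ∀ v ∈ S, ∀ u, G.Move σ v u → u ∈ S ∧ g u ≤ g v + w v u := by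
    intro v hv u hu
    by_cases hva : v ∈ G.alice
    · have := hu.2 hva
      simp only [σ, hv, dite_true] at this
      rw [← this]
      exact (ha v hv hva).choose_spec.2
    · exact hb v hv hva u hu.1
  refine ⟨σ, fun s hs x k hx0 hx => ?_⟩
  -- The local inequalities telescope along the walk; `g ≥ 0` at its end then gives the bound.
  have key : x k ∈ S ∧ g (x k) ≤ g s + walkWeight w x k := by
    clear_value σ
    induction k with
    | zero => simp [walkWeight, hx0, hs]
    | succ k ih =>
      obtain ⟨h₁, h₂⟩ := ih fun i hi => hx i (by omega)
      obtain ⟨h₃, h₄⟩ := hmove _ h₁ _ (hx k (by omega))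
      refine ⟨h₃, ?_⟩
      rw [walkWeight, Finset.sum_range_succ]
      unfold walkWeight at h₂
      linarith
  linarith [hg (x k), key.2]

/-! ### The minimal energy in terms of walks -/

section Energy

variable [Fintype V]

theorem fixedEnergy_le_iff (w : V → V → ℤ) (f : V → V) (s : V) (E : ℕ) :
    fixedEnergy w f s ≤ E ↔
      0 ≤ cycleWeight w f s ∧ ∀ i, IsSimplePath f s i → -(E : ℤ) ≤ pathWeight w f s i := by
  unfold fixedEnergy
  split_ifs with h
  · simp [h]
  · simp only [iSup_le_iff, Nat.cast_le, Int.toNat_le, not_lt.mp h, true_and]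
    exact forall₂_congr fun i _ => by constructor <;> intro <;> linarith

theorem Safe.fixedEnergy_le {σ : G.AliceStrategy} {w : V → V → ℤ} {s : V} {E : ℕ}
    (h : G.Safe σ w s E) (τ : G.BobStrategy) : fixedEnergy w (G.next σ τ) s ≤ E := by
  set f := G.next σ τ with hf
  have hpath : ∀ i, -(E : ℤ) ≤ pathWeight w f s i := fun i =>
    h (fun j => f^[j] s) i rfl fun j _ => by
      simp only [Function.iterate_succ_apply']
      exact move_next σ τ _
  rw [fixedEnergy_le_iff]
  refine ⟨?_, fun i _ => hpath i⟩
  by_contra! hneg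
  -- Each round of a negative cycle loses at least `1`; this many rounds use up `E` and whatever was
  -- gained on the way to the cycle.
  have h₀ := hpath (Fintype.card V + (E + (pathWeight w f s (Fintype.card V)).toNat + 1) *
    cycleLength f s)
  rw [pathWeight_add] at h₀
  change _ ≤ _ + pathWeight w f (cycleNode f s) _ at h₀
  rw [pathWeight_mul_of_periodic w (iterate_cycleLength f s)] at h₀
  change _ ≤ _ + _ * cycleWeight w f s at h₀
  push_cast at h₀
  have := Int.self_le_toNat (pathWeight w f s (Fintype.card V))
  nlinarith [Int.natCast_nonneg (pathWeight w f s (Fintype.card V)).toNat]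

/-- Bob gains nothing from non-positional play. A simple walk is realized by a positional strategy.
In any other walk the first repetition closes a cycle that some positional strategy also runs
through; its weight is nonnegative, so cutting it out leaves a shorter walk that is no heavier. -/
theorem safe_of_fixedEnergy_le {σ : G.AliceStrategy} {w : V → V → ℤ} {s : V} {E : ℕ}
    (h : ∀ τ, fixedEnergy w (G.next σ τ) s ≤ E) : G.Safe σ w s E := by
  intro x k
  induction k using Nat.strong_induction_on generalizing x with
  | _ k ih =>
  intro hx0 hx
  by_cases hinj : Set.InjOn x (Set.Iic k)
  · obtain ⟨τ, hτ⟩ := exists_next_eq_of_injOn σ hx (hinj.mono Set.Iio_subset_Iic_self)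
    have hit : ∀ i ≤ k, (G.next σ τ)^[i] s = x i := fun i hi => by
      rw [← hx0]
      exact iterate_eq_of_step hτ hi
    have hpw : pathWeight w (G.next σ τ) s k = walkWeight w x k := by
      refine Finset.sum_congr rfl fun j hj => ?_
      rw [Finset.mem_range] at hj
      rw [hit j hj.le, hit (j + 1) hj]
    rw [← hpw]
    refine ((fixedEnergy_le_iff _ _ _ _).mp (h τ)).2 k fun i hi j hj hij => hinj hi hj ?_
    simpa [hit i hi, hit j hj] using hij
  -- The least such `j` is taken, so that the nodes before it are distinct.
  · have hex : ∃ j, j ≤ k ∧ ∃ i < j, x i = x j := by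
      simp only [Set.InjOn, not_forall] at hinj
      obtain ⟨i, hi, j, hj, hij, hne⟩ := hinj
      rcases lt_or_gt_of_ne hne with hlt | hlt
      · exact ⟨j, hj, i, hlt, hij⟩
      · exact ⟨i, hi, j, hlt, hij.symm⟩
    classical
    obtain ⟨hjk, i, hij, hxij⟩ := Nat.find_spec hex
    have hmin := fun l => Nat.find_min hex (m := l)
    generalize Nat.find hex = j at *
    have hinj' : Set.InjOn x (Set.Iio j) := by
      intro a ha b hb hab
      by_contra hne
      rcases lt_or_gt_of_ne hne with hlt | hlt
      · exact hmin b hb ⟨le_trans (le_of_lt hb) hjk, a, hlt, hab⟩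
      · exact hmin a ha ⟨le_trans (le_of_lt ha) hjk, b, hlt, hab.symm⟩
    obtain ⟨τ, hτ⟩ := exists_next_eq_of_injOn σ (fun l hl => hx l (by omega)) hinj'
    have hit : ∀ l ≤ j, (G.next σ τ)^[l] s = x l := fun l hl => by
      rw [← hx0]
      exact iterate_eq_of_step hτ hl
    obtain ⟨q, rfl⟩ := Nat.exists_eq_add_of_lt hij
    obtain ⟨r, rfl⟩ := Nat.exists_eq_add_of_le hjk
    obtain ⟨t, ht⟩ := exists_pathWeight_eq_mul_cycleWeight w (G.next σ τ) s (a := i) (q := q + 1)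
      (by rw [← add_assoc, hit _ le_rfl, hit _ (by omega), hxij])
    have hcyc : 0 ≤ ∑ l ∈ Finset.range (q + 1), w (x (i + l)) (x (i + l + 1)) := by
      have : ∑ l ∈ Finset.range (q + 1), w (x (i + l)) (x (i + l + 1)) =
          pathWeight w (G.next σ τ) ((G.next σ τ)^[i] s) (q + 1) := by
        refine Finset.sum_congr rfl fun l hl => ?_
        rw [Finset.mem_range] at hl
        rw [← Function.iterate_add_apply, ← Function.iterate_add_apply, add_comm l i,
          add_right_comm l 1 i, add_comm l i, hit _ (by omega), hit _ (by omega)]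
      rw [this, ht]
      exact mul_nonneg (by positivity) ((fixedEnergy_le_iff _ _ _ _).mp (h τ)).1
    -- The walk without its `q + 1` edges between the two visits to `x i`.
    have hrest := ih (i + r) (by omega) (fun l => if l ≤ i then x l else x (l + (q + 1)))
      (by simpa using hx0) (by
        intro l hl
        rcases lt_trichotomy l i with hli | rfl | hli
        · simpa [hli.le, Nat.succ_le_of_lt hli] using hx l (by omega)
        · have := hx (l + q + 1) (by omega)
          rw [← hxij] at this
          simpa [add_assoc, add_comm, add_left_comm] using this
        · have := hx (l + (q + 1)) (by omega)
          simpa [hli.not_ge, show ¬ l + 1 ≤ i by omega, add_assoc, add_comm, add_left_comm]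
            using this)
    refine hrest.trans ?_
    unfold walkWeight
    rw [add_assoc i q 1, Finset.sum_range_add, Finset.sum_range_add, Finset.sum_range_add]
    have h₁ : ∑ l ∈ Finset.range i, w (if l ≤ i then x l else x (l + (q + 1)))
        (if l + 1 ≤ i then x (l + 1) else x (l + 1 + (q + 1))) =
        ∑ l ∈ Finset.range i, w (x l) (x (l + 1)) := by
      refine Finset.sum_congr rfl fun l hl => ?_
      rw [Finset.mem_range] at hl
      simp [hl.le, Nat.succ_le_of_lt hl]
    have h₂ : ∑ l ∈ Finset.range r, w (if i + l ≤ i then x (i + l) else x (i + l + (q + 1)))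
        (if i + l + 1 ≤ i then x (i + l + 1) else x (i + l + 1 + (q + 1))) =
        ∑ l ∈ Finset.range r, w (x (i + (q + 1) + l)) (x (i + (q + 1) + l + 1)) := by
      refine Finset.sum_congr rfl fun l _ => ?_
      rw [if_neg (show ¬ i + l + 1 ≤ i by omega)]
      rcases Nat.eq_zero_or_pos l with rfl | hl
      · simp only [add_zero, le_refl, if_true, hxij]
        congr 2
        omega
      · rw [if_neg (by omega)]
        congr 2 <;> omega
    rw [h₁, h₂]
    linarith

theorem minEnergy_le_iff (w : V → V → ℤ) (s : V) (E : ℕ) :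
    G.minEnergy w s ≤ E ↔ ∃ σ, G.Safe σ w s E := by
  constructor
  · intro h
    -- The infimum is attained because `ℕ∞` is well-ordered.
    obtain ⟨σ, hσ⟩ := ciInf_mem fun σ : G.AliceStrategy => ⨆ τ, fixedEnergy w (G.next σ τ) s
    refine ⟨σ, safe_of_fixedEnergy_le fun τ => ?_⟩
    refine (le_iSup (fun τ => fixedEnergy w (G.next σ τ) s) τ).trans ?_
    exact hσ.le.trans h
  · rintro ⟨σ, hσ⟩
    exact (iInf_le _ σ).trans (iSup_le hσ.fixedEnergy_le)

theorem minEnergy_mono {w w' : V → V → ℤ} (hw : ∀ u v, w u v ≤ w' u v) (s : V) :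
    G.minEnergy w' s ≤ G.minEnergy w s := by
  induction h : G.minEnergy w s using ENat.recTopCoe with
  | top => exact le_top
  | coe E =>
    obtain ⟨σ, hσ⟩ := (minEnergy_le_iff w s E).mp h.le
    exact (minEnergy_le_iff w' s E).mpr ⟨σ, hσ.mono_weight hw⟩

end Energy

/-! ### Rounded weights -/

/-- The machine only divides with rounding down, so the ceiling is computed as `-⌊-w / B⌋`. -/
theorem roundUp_eq (B : ℕ) (w : V → V → ℤ) (u v : V) :
    roundUp B w u v = (0 - (0 - w u v) / (B : ℤ)) * B := by
  unfold roundUp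
  congr 1
  rw [← neg_neg ((w u v : ℚ) / (B : ℚ)), Int.ceil_neg, ← neg_div, ← Int.cast_neg, zero_sub,
    zero_sub, Rat.floor_intCast_div_natCast]

theorem le_roundUp {B : ℕ} (hB : 0 < B) (w : V → V → ℤ) (u v : V) : w u v ≤ roundUp B w u v := by
  rw [roundUp_eq]
  have := Int.ediv_mul_le (0 - w u v) (b := (B : ℤ)) (by omega)
  linarith

/-- The gain is `B - 1` and not `B` because the weights are integers. This unit of room allows for a
penalty that is a supremum and need not be attained. -/
theorem roundUp_le {B : ℕ} (hB : 0 < B) (w : V → V → ℤ) (u v : V) :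
    roundUp B w u v ≤ w u v + ((B : ℤ) - 1) := by
  rw [roundUp_eq]
  have := Int.lt_ediv_add_one_mul_self (0 - w u v) (b := (B : ℤ)) (by omega)
  linarith

theorem pathWeight_roundUp_le {B : ℕ} (hB : 0 < B) (w : V → V → ℤ) (f : V → V) (s : V) (i : ℕ) :
    pathWeight (roundUp B w) f s i ≤ pathWeight w f s i + i * ((B : ℤ) - 1) := by
  unfold pathWeight
  refine (Finset.sum_le_sum fun j _ => roundUp_le hB w _ _).trans ?_
  rw [Finset.sum_add_distrib, Finset.sum_const, Finset.card_range, nsmul_eq_mul]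

theorem IsSimplePath.lt_card [Fintype V] {f : V → V} {s : V} {i : ℕ} (h : IsSimplePath f s i) :
    i < Fintype.card V := by
  classical
  have := Finset.card_le_card_of_injOn (s := Finset.Iic i) (t := Finset.univ)
    (fun j => f^[j] s) (by simp) (by simpa [IsSimplePath] using h)
  simp at this
  omega

/-! ### Rounding error under the penalty condition -/

section Penalty

variable [Fintype V]

theorem fixedEnergy_le_roundUp_add {B c : ℕ} (hB : 0 < B) (hc : Fintype.card V * B ≤ c)
    {w : V → V → ℤ} {f : V → V} {s : V} {D : ℝ≥0} (hD : (B : ℝ) - 1 < D)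
    (h : cycleWeight w f s < 0 →
      (cycleWeight w f s : ℝ) / (cycleLength f s : ℝ) ≤ -(D : ℝ)) :
    fixedEnergy w f s ≤ fixedEnergy (roundUp B w) f s + (c : ℕ∞) := by
  induction hE : fixedEnergy (roundUp B w) f s using ENat.recTopCoe with
  | top => simp
  | coe E =>
    obtain ⟨h₁, h₂⟩ := (fixedEnergy_le_iff _ _ _ _).mp hE.le
    rw [← Nat.cast_add, fixedEnergy_le_iff]
    constructor
    -- A negative cycle of mean at most `-D` would gain at most `B - 1 < D` per edge, and so remain
    -- negative after rounding.
    · by_contra! hneg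
      have hl : (0 : ℝ) < cycleLength f s := by exact_mod_cast cycleLength_pos f s
      have h₃ := h hneg
      rw [div_le_iff₀ hl] at h₃
      have h₄ : cycleWeight (roundUp B w) f s ≤
          cycleWeight w f s + cycleLength f s * ((B : ℤ) - 1) :=
        pathWeight_roundUp_le hB w f _ _
      have h₅ : (0 : ℝ) ≤ cycleWeight w f s + cycleLength f s * ((B : ℝ) - 1) := by
        exact_mod_cast h₁.trans h₄
      nlinarith
    · intro i hi
      have h₃ := h₂ i hi
      have h₄ := pathWeight_roundUp_le hB w f s i
      have h₅ : (i : ℤ) * ((B : ℤ) - 1) ≤ c := by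
        have : i * B ≤ c := (Nat.mul_le_mul_right B hi.lt_card.le).trans hc
        have : (i : ℤ) * B ≤ c := by exact_mod_cast this
        linarith [Int.natCast_nonneg i]
      push_cast
      linarith

theorem minEnergy_le_roundUp_add {B c : ℕ} (hB : 0 < B) (hc : Fintype.card V * B ≤ c)
    {w : V → V → ℤ} {s : V} (hP : (B : ℝ≥0∞) ≤ G.nodePenalty w s) :
    G.minEnergy w s ≤ G.minEnergy (roundUp B w) s + (c : ℕ∞) := by
  -- As `B - 1` lies strictly below the supremum, some admissible `D` exceeds it.
  have hlt : (((B : ℝ≥0) - 1 : ℝ≥0) : ℝ≥0∞) < G.nodePenalty w s := by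
    refine lt_of_lt_of_le ?_ hP
    have : (B : ℝ≥0) - 1 < B := tsub_lt_self (by exact_mod_cast hB) one_pos
    exact_mod_cast this
  obtain ⟨D, hD⟩ := lt_iSup_iff.mp hlt
  obtain ⟨⟨τ, hopt, hτ⟩, hD⟩ := lt_iSup_iff.mp hD
  have hD' : (B : ℝ) - 1 < D := by
    have h₁ : (B : ℝ≥0) - 1 < D := by exact_mod_cast hD
    have h₂ : (((B : ℝ≥0) - 1 : ℝ≥0) : ℝ) = (B : ℝ) - 1 := by
      rw [NNReal.coe_sub (by exact_mod_cast hB)]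
      simp
    rw [← h₂]
    exact_mod_cast h₁
  -- Alice's strategy is optimal for the rounded weights, while `τ` is optimal for `w`.
  obtain ⟨σ, hσ⟩ := ciInf_mem fun σ : G.AliceStrategy =>
    ⨆ τ, fixedEnergy (roundUp B w) (G.next σ τ) s
  calc G.minEnergy w s ≤ fixedEnergy w (G.next σ τ) s := hopt σ
    _ ≤ fixedEnergy (roundUp B w) (G.next σ τ) s + c :=
      fixedEnergy_le_roundUp_add hB hc hD' (hτ σ)
    _ ≤ G.minEnergy (roundUp B w) s + c := by
      refine add_le_add_left ?_ _
      rw [minEnergy, ← hσ]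
      exact le_iSup (fun τ => fixedEnergy (roundUp B w) (G.next σ τ) s) τ

end Penalty

end GameGraph

/-! ### Progress measures on a list of edges -/

/-- An energy game given by a list of edges; the progress measures take values in `0, …, top`, where
`top` stands for `∞`. -/
structure Arena (n m : ℕ) where
  src : Fin m → Fin n
  tgt : Fin m → Fin n
  wt : Fin m → ℤ
  alice : Set (Fin n)
  top : ℕ
  exists_src : ∀ v, ∃ k, src k = v

namespace Arena

variable {n m : ℕ} (A : Arena n m)

/-- The progress measure `f` satisfies the energy inequality on the edge `k`. -/
def Good (f : Fin n → ℕ) (k : Fin m) : Prop :=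
  f (A.src k) = A.top ∨ (f (A.tgt k) < A.top ∧ (f (A.tgt k) : ℤ) ≤ f (A.src k) + A.wt k)

open Classical in
/-- The indicator function of the good edges. -/
def goodness (f : Fin n → ℕ) (k : Fin m) : ℤ := if A.Good f k then 1 else 0

open Classical in
/-- The number of good out-edges of a node minus the number of those that its owner needs. -/
def slack (ok : Fin m → ℤ) (x : Fin n) : ℤ :=
  if x ∈ A.alice then (∑ k with A.src k = x, ok k) - 1 else ∑ k with A.src k = x, (ok k - 1)

/-- `ok` takes the values `0` and `1` only. -/
def IsBit (ok : Fin m → ℤ) : Prop := ∀ k, ok k = 0 ∨ ok k = 1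

theorem isBit_goodness (f : Fin n → ℕ) : IsBit (A.goodness f) := fun k => by
  unfold goodness
  split_ifs <;> simp

theorem abs_slack_le {ok : Fin m → ℤ} (h : IsBit ok) (x : Fin n) : |A.slack ok x| ≤ m + 1 := by
  classical
  have hcard : ((Finset.univ.filter fun k => A.src k = x).card : ℤ) ≤ m := by
    have := Finset.card_filter_le (Finset.univ : Finset (Fin m)) fun k => A.src k = x
    rw [Finset.card_univ, Fintype.card_fin] at this
    exact_mod_cast this
  have key : ∀ g : Fin m → ℤ, (∀ k, |g k| ≤ 1) → |∑ k with A.src k = x, g k| ≤ m := fun g hg =>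
    (Finset.abs_sum_le_sum_abs _ _).trans <| (Finset.sum_le_sum fun k _ => hg k).trans <| by
      simpa using hcard
  unfold slack
  split_ifs
  · have := key ok fun k => by rcases h k with h | h <;> simp [h]
    rw [abs_le] at *
    constructor <;> linarith
  · exact (key (fun k => ok k - 1) fun k => by rcases h k with h | h <;> simp [h]).trans (by simp)

/-- Only the source of a changed edge is affected, so the machine maintains all slacks in constant
time per edge. -/
theorem slack_update (ok : Fin m → ℤ) (k : Fin m) (b : ℤ) :
    A.slack (Function.update ok k b) =
      Function.update (A.slack ok) (A.src k) (A.slack ok (A.src k) + (b - ok k)) := by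
  classical
  have key : ∀ (x : Fin n) (d : ℤ), ∑ j with A.src j = x, (Function.update ok k b j - d) =
      ∑ j with A.src j = x, (ok j - d) + if x = A.src k then b - ok k else 0 := by
    intro x d
    rw [← sub_eq_iff_eq_add', ← Finset.sum_sub_distrib, Finset.sum_filter]
    rw [Finset.sum_eq_single k]
    · by_cases h : x = A.src k
      · simp [h]
      · simp [h, Ne.symm h]
    · intro j _ hj
      simp [hj]
    · simp
  have key₀ := fun x => key x 0
  simp only [sub_zero] at key₀
  funext x
  by_cases hx : x = A.src k
  · subst hx
    simp only [slack, key, key₀, Function.update_self, if_true]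
    split_ifs <;> ring
  · simp only [slack, key, key₀, Function.update_of_ne hx, if_neg hx, add_zero]

theorem slack_nonneg_of_forall_good {f : Fin n → ℕ} {x : Fin n}
    (h : ∀ k, A.src k = x → A.Good f k) : 0 ≤ A.slack (A.goodness f) x := by
  classical
  have h₁ : ∀ k ∈ Finset.univ.filter (fun k => A.src k = x), A.goodness f k = 1 := fun k hk => by
    simp only [Finset.mem_filter, Finset.mem_univ, true_and] at hk
    simp [goodness, h k hk]
  unfold slack
  split_ifs
  · rw [Finset.sum_congr rfl h₁]
    obtain ⟨k, hk⟩ := A.exists_src x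
    have : 0 < (Finset.univ.filter fun k => A.src k = x).card :=
      Finset.card_pos.mpr ⟨k, by simpa using hk⟩
    simp only [Finset.sum_const, nsmul_eq_mul, mul_one]
    omega
  · exact Finset.sum_nonneg fun k hk => by simp [h₁ k hk]

theorem slack_nonneg_of_exists_good {f : Fin n → ℕ} {x : Fin n} (hx : x ∈ A.alice)
    (h : ∃ k, A.src k = x ∧ A.Good f k) : 0 ≤ A.slack (A.goodness f) x := by
  classical
  obtain ⟨k, hk, hg⟩ := h
  have : A.goodness f k ≤ ∑ k with A.src k = x, A.goodness f k :=
    Finset.single_le_sum (f := A.goodness f)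
      (fun j _ => by rcases A.isBit_goodness f j with h | h <;> simp [h]) (by simpa using hk)
  simp only [goodness, hg, if_true] at this
  simp only [slack, hx, if_true, goodness]
  linarith

theorem exists_good_of_slack_nonneg {f : Fin n → ℕ} {x : Fin n} (hx : x ∈ A.alice)
    (h : 0 ≤ A.slack (A.goodness f) x) : ∃ k, A.src k = x ∧ A.Good f k := by
  classical
  by_contra! hc
  have : ∑ k with A.src k = x, A.goodness f k = 0 := Finset.sum_eq_zero fun k hk => by
    simp only [Finset.mem_filter, Finset.mem_univ, true_and] at hk
    simp [goodness, hc k hk]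
  simp only [slack, hx, if_true, this] at h
  omega

theorem forall_good_of_slack_nonneg {f : Fin n → ℕ} {x : Fin n} (hx : x ∉ A.alice)
    (h : 0 ≤ A.slack (A.goodness f) x) : ∀ k, A.src k = x → A.Good f k := by
  classical
  intro k hk
  by_contra hc
  have h₁ : ∀ j, A.goodness f j - 1 ≤ 0 := fun j => by
    rcases A.isBit_goodness f j with h | h <;> simp [h]
  have h₂ : ∑ j with A.src j = x, (A.goodness f j - 1) < 0 :=
    Finset.sum_neg' (fun j _ => h₁ j) ⟨k, by simpa using hk, by simp [goodness, hc]⟩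
  simp only [slack, hx, if_false] at h
  omega

/-- At a node with value `top` all out-edges are good by definition, so lifting never leaves the
range. -/
theorem lt_top_of_slack_neg {f : Fin n → ℕ} (hf : ∀ v, f v ≤ A.top) {x : Fin n}
    (h : A.slack (A.goodness f) x < 0) : f x < A.top := by
  refine lt_of_le_of_ne (hf x) fun hx => h.not_ge (A.slack_nonneg_of_forall_good fun k hk => ?_)
  exact Or.inl (hk ▸ hx)

/-! ### The least progress measure is the minimal energy -/

variable {A} (G : GameGraph (Fin n)) (edges : Fin m ≃ G.Edge) (a : Fin n → Fin n → ℤ)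

/-- The arena of a game graph whose edges are listed by `edges`. -/
def ofGraph (T : ℕ) : Arena n m where
  src k := (edges k).1.1
  tgt k := (edges k).1.2
  wt k := a (edges k).1.1 (edges k).1.2
  alice := G.alice
  top := T
  exists_src v := by
    obtain ⟨u, hu⟩ := G.exists_adj v
    exact ⟨edges.symm ⟨(v, u), hu⟩, by simp⟩

/-- `f` is a lower bound for all sufficient energies, in units of `B`. -/
def IsLowerBound (w : Fin n → Fin n → ℤ) (B T : ℕ) (f : Fin n → ℕ) : Prop :=
  ∀ v σ E, G.Safe σ w v E → f v < T ∧ (f v * B : ℤ) ≤ E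

variable {G} {a} {w : Fin n → Fin n → ℤ} {B M : ℕ}

/-- If less than `(f x + 1) * B` sufficed in `x`, then so would `f x * B`, by divisibility. After
any allowed move the remaining energy suffices at the new node and is thus bounded below by `f`
there, so the edge is good. Then `x` does not lack good edges. -/
theorem IsLowerBound.lift (hB : 0 < B) (hw : ∀ u v, w u v = a u v * B)
    (hM : G.IsFiniteEnergyBound w M) {f : Fin n → ℕ}
    (hf : IsLowerBound G w B (M / B + 1) f) {x : Fin n}
    (hx : (ofGraph G edges a (M / B + 1)).slack
      ((ofGraph G edges a (M / B + 1)).goodness f) x < 0) :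
    IsLowerBound G w B (M / B + 1) (Function.update f x (f x + 1)) := by
  have hBz : (0 : ℤ) < B := by exact_mod_cast hB
  have key : ∀ σ E, G.Safe σ w x E → ((f x + 1 : ℕ) * B : ℤ) ≤ E := by
    intro σ E hE
    by_contra! hlt
    push_cast at hlt
    have hs := hE.of_lt_mul_succ hBz hw hlt
    have hgood : ∀ k, G.Move σ x (edges k).1.2 → (edges k).1.1 = x →
        (ofGraph G edges a (M / B + 1)).Good f k := by
      intro k hk hk'
      obtain ⟨h₁, h₂⟩ := hf _ _ _ (hs.step hk)
      refine Or.inr ⟨h₁, ?_⟩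
      rw [hw, ← add_mul] at h₂
      have := le_of_mul_le_mul_right h₂ hBz
      simpa [ofGraph, hk'] using this
    refine hx.not_ge ?_
    by_cases hxa : x ∈ G.alice
    · refine slack_nonneg_of_exists_good _ hxa
        ⟨edges.symm ⟨(x, σ ⟨x, hxa⟩), (σ ⟨x, hxa⟩).2⟩, by simp [ofGraph], hgood _ ?_ (by simp)⟩
      simpa [GameGraph.Move] using (σ ⟨x, hxa⟩).2
    · refine slack_nonneg_of_forall_good _ fun k hk => hgood k ⟨?_, fun h => absurd h hxa⟩ hk
      have hk' : (edges k).1.1 = x := hk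
      rw [← hk']
      exact (edges k).2
  intro v σ E hE
  by_cases hv : v = x
  · subst hv
    simp only [Function.update_self]
    refine ⟨?_, key σ E hE⟩
    obtain ⟨E', rfl⟩ := Int.eq_ofNat_of_zero_le hE.nonneg
    have hle := (GameGraph.minEnergy_le_iff w v E').mpr ⟨σ, hE⟩
    obtain ⟨σ', hσ'⟩ := (GameGraph.minEnergy_le_iff w v M).mp
      (hM v (ne_top_of_le_ne_top (ENat.natCast_ne_top E') hle))
    -- If any energy suffices in `v`, then `M` does, which keeps the lifted value below `M / B + 1`.
    have : (f v + 1) * B ≤ M := by exact_mod_cast key σ' M hσ'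
    have := (Nat.le_div_iff_mul_le hB).mpr this
    omega
  · simp only [Function.update_of_ne hv]
    exact hf v σ E hE

theorem isLowerBound_zero : IsLowerBound G w B (M / B + 1) fun _ => 0 := fun _ _ _ h =>
  ⟨Nat.succ_pos _, by simpa using h.nonneg⟩

/-- Where no node lacks good edges, `f * B` satisfies the energy inequalities on `{f < T}`, so one
strategy of Alice realizes it there. The other inequality, and infinity where `f = T`, come from the
lower bound property. -/
theorem minEnergy_eq (hw : ∀ u v, w u v = a u v * B) (hB : 0 < B) {T : ℕ} {f : Fin n → ℕ}
    (hf : IsLowerBound G w B T f)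
    (hs : ∀ x, 0 ≤ (ofGraph G edges a T).slack ((ofGraph G edges a T).goodness f) x) (v : Fin n) :
    G.minEnergy w v = if f v < T then ((f v * B : ℕ) : ℕ∞) else ⊤ := by
  have hgood : ∀ k, f (edges k).1.1 < T → (ofGraph G edges a T).Good f k →
      f (edges k).1.2 < T ∧ (f (edges k).1.2 * B : ℤ) ≤
        f (edges k).1.1 * B + w (edges k).1.1 (edges k).1.2 := by
    rintro k hk (h | ⟨h₁, h₂⟩)
    · exact absurd h hk.ne
    · refine ⟨h₁, ?_⟩
      rw [hw, ← add_mul]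
      exact mul_le_mul_of_nonneg_right h₂ (by positivity)
  obtain ⟨σ, hσ⟩ := GameGraph.exists_safe_of_local (G := G) w {v | f v < T} (fun v => f v * B)
    (fun v => by positivity)
    (fun v hv ha => by
      obtain ⟨k, hk, hg⟩ := exists_good_of_slack_nonneg _ ha (hs v)
      have hk' : (edges k).1.1 = v := hk
      have := hgood k (by rw [hk']; exact hv) hg
      rw [hk'] at this
      exact ⟨_, hk' ▸ (edges k).2, this⟩)
    (fun v hv ha u hu => by
      have hg := forall_good_of_slack_nonneg _ ha (hs v) (edges.symm ⟨(v, u), hu⟩)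
        (by simp [ofGraph])
      simpa using hgood (edges.symm ⟨(v, u), hu⟩) (by simpa using hv) hg)
  split_ifs with hv
  · refine le_antisymm ((GameGraph.minEnergy_le_iff w v _).mpr ⟨σ, ?_⟩) ?_
    · simpa using hσ v hv
    · induction h : G.minEnergy w v using ENat.recTopCoe with
      | top => exact le_top
      | coe E =>
        obtain ⟨σ', hσ'⟩ := (GameGraph.minEnergy_le_iff w v E).mp h.le
        exact_mod_cast (hf v σ' E hσ').2
  · induction h : G.minEnergy w v using ENat.recTopCoe with
    | top => rfl
    | coe E =>
      obtain ⟨σ', hσ'⟩ := (GameGraph.minEnergy_le_iff w v E).mp h.le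
      exact absurd (hf v σ' E hσ').1 hv

end Arena

namespace RAM

/-! ### Total correctness with a time budget -/

/-- Started in `s`, the program `p` halts within `t` steps in a store with the property `Q`. -/
def Halts (N : ℕ) (p : Program) (s : Store) (t : ℕ) (Q : Store → Prop) : Prop :=
  ∃ t' s', Runs N p s t' s' ∧ t' ≤ t ∧ Q s'

section Rules

variable {N : ℕ} {p q : Program} {s : Store} {t t₁ t₂ : ℕ} {Q R : Store → Prop} {e : Expr}

theorem Halts.mono (h : Halts N p s t₁ Q) (ht : t₁ ≤ t₂) (hQ : ∀ s', Q s' → R s') :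
    Halts N p s t₂ R := by
  obtain ⟨t', s', h₁, h₂, h₃⟩ := h
  exact ⟨t', s', h₁, h₂.trans ht, hQ _ h₃⟩

theorem Halts.skip (ht : 1 ≤ t) (hQ : Q s) : Halts N .skip s t Q := ⟨1, s, .skip s, ht, hQ⟩

theorem Halts.assign {i : ℕ} (h : e.Fits N s) (ht : e.cost + 1 ≤ t)
    (hQ : Q (s.setReg i (e.eval s))) : Halts N (.assign i e) s t Q :=
  ⟨_, _, .assign i e s h, ht, hQ⟩

theorem Halts.write {a : ℕ} {idx : Expr} (hi : idx.Fits N s) (h : e.Fits N s)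
    (ht : idx.cost + e.cost + 1 ≤ t) (hQ : Q (s.setArr a (idx.eval s) (e.eval s))) :
    Halts N (.write a idx e) s t Q :=
  ⟨_, _, .write a idx e s hi h, ht, hQ⟩

theorem Halts.seq (h : Halts N p s t₁ fun s' => Halts N q s' t₂ Q) (ht : t₁ + t₂ ≤ t) :
    Halts N (.seq p q) s t Q := by
  obtain ⟨t', s', h₁, h₂, t'', s'', h₃, h₄, h₅⟩ := h
  exact ⟨_, _, .seq h₁ h₃, by omega, h₅⟩

theorem Halts.assign_seq {i : ℕ} (z : ℤ) (h : e.Fits N s) (hz : e.eval s = z)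
    (ht : e.cost + 1 ≤ t) (hq : Halts N q (s.setReg i z) (t - (e.cost + 1)) Q) :
    Halts N (.seq (.assign i e) q) s t Q :=
  Halts.seq (Halts.assign h le_rfl (hz ▸ hq)) (by omega)

theorem Halts.write_seq {a : ℕ} {idx : Expr} (y z : ℤ) (hi : idx.Fits N s) (h : e.Fits N s)
    (hy : idx.eval s = y) (hz : e.eval s = z) (ht : idx.cost + e.cost + 1 ≤ t)
    (hq : Halts N q (s.setArr a y z) (t - (idx.cost + e.cost + 1)) Q) :
    Halts N (.seq (.write a idx e) q) s t Q :=
  Halts.seq (Halts.write hi h le_rfl (hy ▸ hz ▸ hq)) (by omega)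

theorem Halts.cond (h : e.Fits N s) (hp : e.eval s ≠ 0 → Halts N p s t₁ Q)
    (hq : e.eval s = 0 → Halts N q s t₁ Q) (ht : e.cost + 1 + t₁ ≤ t) :
    Halts N (.cond e p q) s t Q := by
  by_cases he : e.eval s = 0
  · obtain ⟨t', s', h₁, h₂, h₃⟩ := hq he
    exact ⟨_, _, .cond_false h he h₁, by omega, h₃⟩
  · obtain ⟨t', s', h₁, h₂, h₃⟩ := hp he
    exact ⟨_, _, .cond_true h he h₁, by omega, h₃⟩

theorem Halts.loop_true (h : e.Fits N s) (he : e.eval s ≠ 0)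
    (hp : Halts N p s t₁ fun s' => Halts N (.loop e p) s' t₂ Q) (ht : e.cost + 1 + t₁ + t₂ ≤ t) :
    Halts N (.loop e p) s t Q := by
  obtain ⟨t', s', h₁, h₂, t'', s'', h₃, h₄, h₅⟩ := hp
  exact ⟨_, _, .loop_true h he h₁ h₃, by omega, h₅⟩

theorem Halts.loop_false (h : e.Fits N s) (he : e.eval s = 0) (ht : e.cost + 1 ≤ t) (hQ : Q s) :
    Halts N (.loop e p) s t Q :=
  ⟨_, _, .loop_false h he, ht, hQ⟩

/-- A loop whose iterations are paid for by a potential `φ`. -/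
theorem Halts.loop (I : ℕ → Store → Prop) (hfit : ∀ φ s, I φ s → e.Fits N s)
    (hstep : ∀ φ s, I φ s → e.eval s ≠ 0 → ∃ d, Halts N p s d fun s' =>
      ∃ φ', I φ' s' ∧ φ' + d + e.cost + 1 ≤ φ) {φ : ℕ} (h : I φ s) (ht : φ + e.cost + 1 ≤ t) :
    Halts N (.loop e p) s t fun s' => (∃ φ', I φ' s') ∧ e.eval s' = 0 := by
  induction φ using Nat.strong_induction_on generalizing s t with
  | _ φ ih =>
  by_cases he : e.eval s = 0
  · exact Halts.loop_false (hfit φ s h) he (by omega) ⟨⟨φ, h⟩, he⟩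
  · obtain ⟨d, t', s', h₁, h₂, φ', h₃, h₄⟩ := hstep φ s h he
    exact Halts.loop_true (t₁ := d) (t₂ := φ' + e.cost + 1) (hfit φ s h) he
      ⟨t', s', h₁, h₂, ih φ' (by omega) h₃ le_rfl⟩ (by omega)

/-- Run `p` for the values `0, 1, …, b - 1` of register `8`. -/
def forLoop (b : Expr) (p : Program) : Program :=
  .seq (.assign 8 (.const 0)) (.loop (.op .lt (.reg 8) b)
    (.seq p (.assign 8 (.op .add (.reg 8) (.const 1)))))

@[simp] theorem Store.reg_setReg (s : Store) (i j : ℕ) (z : ℤ) :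
    (s.setReg i z).reg j = if j = i then z else s.reg j := by
  simp [Store.setReg, Function.update_apply]

@[simp] theorem Store.arr_setReg (s : Store) (i : ℕ) (z : ℤ) : (s.setReg i z).arr = s.arr := rfl

@[simp] theorem Store.reg_setArr (s : Store) (a : ℕ) (i z : ℤ) : (s.setArr a i z).reg = s.reg := rfl

@[simp] theorem Store.arr_setArr (s : Store) (a b : ℕ) (i j z : ℤ) :
    (s.setArr a i z).arr b j = if b = a ∧ j = i then z else s.arr b j := by
  by_cases h : b = a
  · subst h
    simp [Store.setArr, Function.update_apply]
  · simp [Store.setArr, h]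

/-- The invariant is indexed by the number of finished rounds and must not depend on the counter;
the body has to leave the counter as it found it. -/
theorem Halts.forLoop {b : Expr} {I : ℕ → Store → Prop} {K d : ℕ} (hK : K < N)
    (hb : ∀ i s, I i s → b.Fits N s ∧ b.eval s = K)
    (hI : ∀ i s z, I i s → I i (s.setReg 8 z))
    (hp : ∀ i < K, ∀ s, I i s → s.reg 8 = i → Halts N p s d fun s' => I (i + 1) s' ∧ s'.reg 8 = i)
    (h : I 0 s) (ht : (K + 1) * (d + b.cost + 10) ≤ t) :
    Halts N (RAM.forLoop b p) s t (I K) := by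
  have hrun : ∀ r i s, i + r = K → I i s → s.reg 8 = i →
      Halts N (.loop (.op .lt (.reg 8) b) (.seq p (.assign 8 (.op .add (.reg 8) (.const 1))))) s
        ((r + 1) * (d + b.cost + 8)) (I K) := by
    intro r
    induction r with
    | zero =>
      intro i s hi hs h8
      obtain ⟨h₁, h₂⟩ := hb i s hs
      refine Halts.loop_false ⟨?_, h₁, ?_⟩ ?_ ?_ ?_
      · simp only [Expr.Fits, h8, abs_le]
        omega
      · simp only [Op.eval, abs_le]
        split_ifs <;> omega
      · simp only [Expr.eval, Op.eval, h8, h₂]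
        rw [if_neg (by omega)]
      · simp only [Expr.cost]
        omega
      · rw [← hi]
        exact hs
    | succ r ih =>
      intro i s hi hs h8
      obtain ⟨h₁, h₂⟩ := hb i s hs
      refine Halts.loop_true (t₁ := d + 4) (t₂ := (r + 1) * (d + b.cost + 8)) ⟨?_, h₁, ?_⟩ ?_
        (Halts.seq (t₁ := d) (t₂ := 4) ((hp i (by omega) s hs h8).mono le_rfl ?_) le_rfl) ?_
      · simp only [Expr.Fits, h8, abs_le]
        omega
      · simp only [Op.eval, abs_le]
        split_ifs <;> omega
      · simp only [Expr.eval, Op.eval, h8, h₂]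
        rw [if_pos (by omega)]
        exact one_ne_zero
      · rintro s' ⟨hs', h8'⟩
        refine Halts.assign ?_ (by simp [Expr.cost])
          (ih (i + 1) _ (by omega) (hI _ _ _ hs') (by simp [Expr.eval, Op.eval, h8']))
        simp only [Expr.Fits, Expr.eval, Op.eval, h8', abs_le]
        omega
      · simp only [Expr.cost]
        ring_nf
        omega
  refine Halts.assign_seq 0 (by simp [Expr.Fits]) rfl ?_ ?_
  · simp only [Expr.cost]
    nlinarith
  · refine (hrun K 0 _ (by omega) (hI _ _ _ h) (by simp)).mono ?_ fun _ h => h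
    simp only [Expr.cost]
    have : (K + 1) * (d + b.cost + 10) = (K + 1) * (d + b.cost + 8) + 2 * (K + 1) := by ring
    omega

end Rules

/-! ### The program -/

/-- Recompute whether the edge in register `9` is good, and push its source if this node lacks good
edges. -/
def refresh : Program :=
  .seq (.assign 10 (.get 0 (.reg 9))) <|
  -- Truth values are `0` and `1`: a sum greater than `0` is a disjunction, a product a conjunction,
  -- and `y ≤ z` is tested as `y < z + 1`.
  .seq (.assign 11 (.op .lt (.const 0) (.op .add (.op .eq (.get 4 (.reg 10)) (.reg 5))
    (.op .mul (.op .lt (.get 4 (.get 1 (.reg 9))) (.reg 5))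
      (.op .lt (.get 4 (.get 1 (.reg 9)))
        (.op .add (.op .add (.get 4 (.reg 10)) (.get 7 (.reg 9))) (.const 1))))))) <|
  .seq (.write 9 (.reg 10) (.op .add (.get 9 (.reg 10)) (.op .sub (.reg 11) (.get 8 (.reg 9))))) <|
  .seq (.write 8 (.reg 9) (.reg 11)) <|
  .cond (.op .lt (.get 9 (.reg 10)) (.const 0))
    (.seq (.write 10 (.reg 6) (.reg 10)) (.assign 6 (.op .add (.reg 6) (.const 1)))) .skip

variable {n m : ℕ} (A : Arena n m)

/-- The node that belongs to an entry of the incidence lists: entry `2 * k` is the edge `k` at its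
source, and entry `2 * k + 1` is the edge `k` at its target. -/
def entryNode (j : ℕ) : Option (Fin n) :=
  if h : j / 2 < m then
    some (if j % 2 = 0 then A.src ⟨j / 2, h⟩ else A.tgt ⟨j / 2, h⟩)
  else none

/-- The last entry at `v` among the first `i` entries, increased by `1`; it is `0` if there is no
such entry. -/
def lastEntry (v : Fin n) : ℕ → ℕ
  | 0 => 0
  | j + 1 => if entryNode A j = some v then j + 1 else lastEntry v j

/-- The number of entries at `v` among the first `i` entries. -/
def entryCount (v : Fin n) (i : ℕ) : ℕ :=
  ((Finset.range i).filter fun j => entryNode A j = some v).card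

/-- The parts of the store that do not change in the main loop. -/
structure Static (B : ℕ) (s : Store) : Prop where
  reg_zero : s.reg 0 = n
  reg_one : s.reg 1 = m
  reg_four : s.reg 4 = B
  reg_five : s.reg 5 = A.top
  src : ∀ k : Fin m, s.arr 0 k = (A.src k : ℕ)
  tgt : ∀ k : Fin m, s.arr 1 k = (A.tgt k : ℕ)
  wt : ∀ k : Fin m, s.arr 7 k = A.wt k
  head : ∀ v : Fin n, s.arr 5 v = lastEntry A v (2 * m)
  next : ∀ j v, entryNode A j = some v → s.arr 6 j = lastEntry A v j

/-- The parts of the store that change in the main loop; the stack has height `h`. -/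
structure Dynamic (f : Fin n → ℕ) (ok : Fin m → ℤ) (h : ℕ) (s : Store) : Prop where
  measure : ∀ v : Fin n, s.arr 4 v = f v
  bits : ∀ k : Fin m, s.arr 8 k = ok k
  slack : ∀ v : Fin n, s.arr 9 v = A.slack ok v
  height : s.reg 6 = h
  stack : ∀ i : ℕ, i < h → ∃ x : Fin n, s.arr 10 i = (x : ℕ)
  mem_stack : ∀ x : Fin n, A.slack ok x < 0 → ∃ i : ℕ, i < h ∧ s.arr 10 i = (x : ℕ)

/-- A bound `H` on the numbers that occur. -/
structure Bounds (N H : ℕ) : Prop where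
  limit : 4 * H + 8 ≤ N
  nodes : n ≤ H
  edges : 2 * m ≤ H
  top : A.top ≤ H
  wt : ∀ k, |A.wt k| ≤ H

variable {A} {B N H h : ℕ} {f : Fin n → ℕ} {ok : Fin m → ℤ} {s : Store}

/-- The stack may contain a node repeatedly, or one that lacks nothing; only its completeness
matters. Just the source of the edge can start to lack good edges, so one push suffices. -/
theorem halts_refresh (hN : Bounds A N H) (hs : Static A B s) (hd : Dynamic A f ok h s)
    (hok : Arena.IsBit ok) (hf : ∀ v, f v ≤ A.top) (hh : h + 1 ≤ H) {k : Fin m}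
    (hk : s.reg 9 = k) :
    Halts N refresh s 60 fun s' => s'.reg 8 = s.reg 8 ∧ Static A B s' ∧
      ∃ h' ≤ h + 1, Dynamic A f (Function.update ok k (A.goodness f k)) h' s' := by
  classical
  obtain ⟨hN1, hN2, hN3, hN4, hN5⟩ := hN
  have hw := abs_le.mp (hN5 k)
  have hx := (A.src k).2
  have hy := (A.tgt k).2
  have hkm := k.2
  have hfx := hf (A.src k)
  have hfy := hf (A.tgt k)
  have hslack := abs_le.mp (A.abs_slack_le hok (A.src k))
  have hg : A.goodness f k = 0 ∨ A.goodness f k = 1 := A.isBit_goodness f k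
  have hokk := hok k
  have h0 := hs.src k
  have h1 := hs.tgt k
  have h7 := hs.wt k
  have h5 := hs.reg_five
  have h4x := hd.measure (A.src k)
  have h4y := hd.measure (A.tgt k)
  have h8 := hd.bits k
  have h9 := hd.slack (A.src k)
  have h6 := hd.height
  refine Halts.assign_seq (A.src k : ℕ) ?_ ?_ (by decide) ?_
  · simp only [Expr.Fits, Expr.eval, hk, h0, abs_le]
    omega
  · simp [Expr.eval, hk, h0]
  refine Halts.assign_seq (A.goodness f k) ?_ ?_ (by decide) ?_
  · simp only [Expr.Fits, Expr.eval, Op.eval, Store.reg_setReg, Store.arr_setReg, hk, h1, h4x,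
      h4y, h5, h7, abs_le, Nat.reduceEqDiff, if_true, if_false]
    split_ifs <;> omega
  · simp only [Expr.eval, Op.eval, Store.reg_setReg, Store.arr_setReg, hk, h1, h4x,
      h4y, h5, h7, Nat.reduceEqDiff, if_true, if_false, Arena.goodness, Arena.Good]
    split_ifs <;> omega
  refine Halts.write_seq (A.src k : ℕ) (A.slack ok (A.src k) + (A.goodness f k - ok k))
    ?_ ?_ ?_ ?_ (by decide) ?_
  · simp [Expr.Fits]
    omega
  · simp [Expr.Fits, Expr.eval, Op.eval, hk, h9, h8, abs_le]
    omega
  · simp [Expr.eval]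
  · simp [Expr.eval, Op.eval, hk, h9, h8]
  refine Halts.write_seq (k : ℕ) (A.goodness f k) ?_ ?_ ?_ ?_ (by decide) ?_
  · simp [Expr.Fits, hk]
    omega
  · simp [Expr.Fits, abs_le]
    omega
  · simp [Expr.eval, hk]
  · simp [Expr.eval]
  have hupd := A.slack_update ok k (A.goodness f k)
  have hnat : ∀ (i j : ℕ), ((i : ℤ) = (j : ℤ)) = (i = j) := fun i j => by simp
  have hok' : ∀ j : Fin m, (if (j : ℕ) = (k : ℕ) then A.goodness f k else s.arr 8 j) =
      Function.update ok k (A.goodness f k) j := fun j => by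
    by_cases h : j = k
    · simp [h]
    · simp [h, Fin.val_inj, hd.bits]
  have hsl' : ∀ v : Fin n, (if (v : ℕ) = (A.src k : ℕ) then
      A.slack ok (A.src k) + (A.goodness f k - ok k) else s.arr 9 v) =
      A.slack (Function.update ok k (A.goodness f k)) v := fun v => by
    rw [hupd]
    by_cases h : v = A.src k
    · simp [h]
    · simp [h, Fin.val_inj, hd.slack]
  refine Halts.cond (t₁ := 8) ?_ ?_ ?_ (by decide)
  · simp [Expr.Fits, Expr.eval, Op.eval, abs_le]
    split_ifs <;> omega
  · intro _
    refine Halts.write_seq (h : ℕ) (A.src k : ℕ) ?_ ?_ ?_ ?_ (by decide) ?_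
    · simp [Expr.Fits, h6]
      omega
    · simp [Expr.Fits]
      omega
    · simp [Expr.eval, h6]
    · simp [Expr.eval]
    refine Halts.assign ?_ (by decide) ⟨by simp, ?_, h + 1, le_rfl, ?_⟩
    · simp [Expr.Fits, Expr.eval, Op.eval, abs_le, h6]
      omega
    · constructor <;> simp [hs.reg_zero, hs.reg_one, hs.reg_four, hs.reg_five, hs.src, hs.tgt,
        hs.wt, hs.head]
      exact hs.next
    · constructor
      · simpa using hd.measure
      · simpa [hnat] using hok'
      · simpa [hnat] using hsl'
      · simp [Expr.eval, Op.eval, h6]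
      · intro i hi
        by_cases hih : i = h
        · exact ⟨A.src k, by simp [hih]⟩
        · obtain ⟨x, hx⟩ := hd.stack i (by omega)
          exact ⟨x, by simp [hih, hx]⟩
      · intro x hx
        by_cases hxk : x = A.src k
        · exact ⟨h, by omega, by simp [hxk]⟩
        · rw [hupd, Function.update_of_ne hxk] at hx
          obtain ⟨i, hi, hix⟩ := hd.mem_stack x hx
          exact ⟨i, by omega, by simp [hi.ne, hix]⟩
  · intro hneg
    refine Halts.skip (by decide) ⟨by simp, ?_, h, by omega, ?_⟩
    · constructor <;> simp [hs.reg_zero, hs.reg_one, hs.reg_four, hs.reg_five, hs.src, hs.tgt,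
        hs.wt, hs.head]
      exact hs.next
    · constructor
      · simpa using hd.measure
      · simpa [hnat] using hok'
      · simpa [hnat] using hsl'
      · simp [h6]
      · simpa using hd.stack
      · intro x hx
        by_cases hxk : x = A.src k
        · subst hxk
          rw [hupd, Function.update_self] at hx
          simp [Expr.eval, Op.eval] at hneg
          omega
        · rw [hupd, Function.update_of_ne hxk] at hx
          simpa using hd.mem_stack x hx

end RAM

/-! ### The main loop and its running time -/

namespace RAM

/-- Refresh all edges in the incidence list that starts with the entry in register `8`. -/
def scan : Program :=
  .loop (.reg 8) <|
    .seq (.assign 9 (.op .div (.op .sub (.reg 8) (.const 1)) (.const 2))) <|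
    .seq refresh (.assign 8 (.get 6 (.op .sub (.reg 8) (.const 1))))

/-- As long as the stack is nonempty: increase the measure of its top node if this node lacks good
edges, and remove the node from the stack otherwise. -/
def mainLoop : Program :=
  .loop (.reg 6) <|
    .seq (.assign 7 (.get 10 (.op .sub (.reg 6) (.const 1)))) <|
    .cond (.op .lt (.get 9 (.reg 7)) (.const 0))
      (.seq (.write 4 (.reg 7) (.op .add (.get 4 (.reg 7)) (.const 1))) <|
        .seq (.assign 8 (.get 5 (.reg 7))) scan)
      (.assign 6 (.op .sub (.reg 6) (.const 1)))

variable {n m : ℕ} {A : Arena n m} {B N H h : ℕ} {f : Fin n → ℕ} {ok : Fin m → ℤ} {s : Store}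

theorem entryCount_succ (v : Fin n) (i : ℕ) : entryCount A v (i + 1) =
    entryCount A v i + if entryNode A i = some v then 1 else 0 := by
  unfold entryCount
  rw [Finset.range_add_one, Finset.filter_insert]
  split_ifs
  · rw [Finset.card_insert_of_notMem (by simp)]
  · rfl

theorem sum_entryCount_le (i : ℕ) : ∑ v, entryCount A v i ≤ i := by
  induction i with
  | zero => simp [entryCount]
  | succ i ih =>
    simp only [entryCount_succ, Finset.sum_add_distrib]
    refine add_le_add ih ?_
    cases entryNode A i <;> simp

theorem lastEntry_le (v : Fin n) (i : ℕ) : lastEntry A v i ≤ i := by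
  induction i with
  | zero => rfl
  | succ i ih =>
    unfold lastEntry
    split_ifs <;> omega

theorem Static.congr {s s' : Store} (hs : Static A B s) (hr : ∀ i < 6, s'.reg i = s.reg i)
    (ha : ∀ a ∈ [0, 1, 5, 6, 7], s'.arr a = s.arr a) : Static A B s' := by
  simp only [List.mem_cons, List.not_mem_nil, or_false, forall_eq_or_imp, forall_eq] at ha
  obtain ⟨h0, h1, h5, h6, h7⟩ := ha
  constructor <;> simp only [hr, h0, h1, h5, h6, h7, Nat.reduceLT]
  exacts [hs.1, hs.2, hs.3, hs.4, hs.5, hs.6, hs.7, hs.8, hs.9]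

theorem Dynamic.congr {s s' : Store} (hd : Dynamic A f ok h s) (hr : s'.reg 6 = s.reg 6)
    (ha : ∀ a ∈ [4, 8, 9, 10], s'.arr a = s.arr a) : Dynamic A f ok h s' := by
  simp only [List.mem_cons, List.not_mem_nil, or_false, forall_eq_or_imp, forall_eq] at ha
  obtain ⟨h4, h8, h9, h10⟩ := ha
  constructor <;> simp only [hr, h4, h8, h9, h10]
  exacts [hd.1, hd.2, hd.3, hd.4, hd.5, hd.6]

theorem isBit_update {ok : Fin m → ℤ} (hok : Arena.IsBit ok) (k : Fin m) :
    Arena.IsBit (Function.update ok k (A.goodness f k)) := fun j => by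
  rw [Function.update_apply]
  split_ifs
  · exact A.isBit_goodness f k
  · exact hok j

/-- Arrays `5` and `6` hold linked lists: heads and successors, as entry numbers plus `1`, with `0`
at the end. The induction runs over all entry numbers; those that do not belong to `v` are skipped
by `lastEntry` and cost nothing. -/
theorem halts_scan (hN : Bounds A N H) (hf : ∀ v, f v ≤ A.top) (v : Fin n) {i : ℕ}
    (hi : i ≤ 2 * m) {ok : Fin m → ℤ} {h : ℕ} {s : Store} (hs : Static A B s)
    (hd : Dynamic A f ok h s) (hok : Arena.IsBit ok) (hh : h + entryCount A v i ≤ H)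
    (h8 : s.reg 8 = lastEntry A v i) :
    Halts N scan s (80 * entryCount A v i + 2) fun s' => Static A B s' ∧
      ∃ ok', ∃ h' ≤ h + entryCount A v i, Dynamic A f ok' h' s' ∧ Arena.IsBit ok' ∧
        (∀ k, ok k = A.goodness f k → ok' k = A.goodness f k) ∧
        ∀ j < i, entryNode A j = some v → ∀ hj : j / 2 < m,
          ok' ⟨j / 2, hj⟩ = A.goodness f ⟨j / 2, hj⟩ := by
  induction i generalizing ok h s with
  | zero =>
    refine Halts.loop_false ?_ ?_ (by simp [Expr.cost])
      ⟨hs, ok, h, by simp, hd, hok, fun _ h => h, by simp⟩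
    · simp [Expr.Fits, h8, lastEntry]
    · simp [Expr.eval, h8, lastEntry]
  | succ i ih =>
    rw [entryCount_succ] at hh ⊢
    by_cases hv : entryNode A i = some v
    · rw [if_pos hv] at hh ⊢
      rw [lastEntry, if_pos hv] at h8
      have him : i / 2 < m := by omega
      have h₁ := hN.limit
      have h₂ := hN.edges
      have hnext := hs.next i v hv
      have hlast := lastEntry_le (A := A) v i
      refine Halts.loop_true (t₁ := 78) (t₂ := 80 * entryCount A v i + 2) ?_ ?_ ?_
        (by simp only [Expr.cost]; omega)
      · simp only [Expr.Fits, h8, abs_le]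
        omega
      · simp only [Expr.eval, h8]
        omega
      refine Halts.assign_seq ((i / 2 : ℕ) : ℤ) ?_ ?_ (by decide) ?_
      · simp only [Expr.Fits, Expr.eval, Op.eval, h8, abs_le]
        push_cast
        simp only [add_sub_cancel_right]
        omega
      · simp [Expr.eval, Op.eval, h8]
      refine Halts.seq (t₁ := 60) (t₂ := 10) ?_ (by decide)
      refine (halts_refresh hN (k := ⟨i / 2, him⟩)
        (hs.congr (by intro j hj; simp; omega) (by simp))
        (hd.congr (by simp) (by simp)) hok hf (by omega) (by simp)).mono le_rfl ?_
      rintro s' ⟨hs8, hs', h', hh', hd'⟩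
      have h8' : s'.reg 8 = (i + 1 : ℕ) := by simpa [h8] using hs8
      have hnext' := hs'.next i v hv
      have hidx : ((i + 1 : ℕ) : ℤ) - 1 = i := by push_cast; ring
      refine Halts.assign ?_ (by decide) ?_
      · simp only [Expr.Fits, Expr.eval, Op.eval, h8', hidx, hnext', abs_le]
        omega
      · refine (ih (by omega) (hs'.congr (by intro j hj; simp; omega) (by simp))
          (hd'.congr (by simp) (by simp)) (isBit_update hok _) (by omega) ?_).mono le_rfl ?_
        · simp only [Expr.eval, Op.eval, Store.reg_setReg, if_true, h8', hidx, hnext']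
        · rintro s'' ⟨hs'', ok'', h'', hh'', hd'', hok'', h₃, h₄⟩
          refine ⟨hs'', ok'', h'', by omega, hd'', hok'', fun k hk => h₃ k ?_, fun j hj hjv hjm => ?_⟩
          · rw [Function.update_apply]
            split_ifs with hk'
            · rw [hk']
            · exact hk
          · rcases Nat.lt_succ_iff_lt_or_eq.mp hj with hj | rfl
            · exact h₄ j hj hjv hjm
            · exact h₃ _ (by simp)
    · rw [if_neg hv] at hh ⊢
      rw [lastEntry, if_neg hv] at h8
      refine (ih (by omega) hs hd hok hh h8).mono le_rfl ?_
      rintro s'' ⟨hs'', ok'', h'', hh'', hd'', hok'', h₃, h₄⟩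
      refine ⟨hs'', ok'', h'', by omega, hd'', hok'', h₃, fun j hj hjv hjm => ?_⟩
      rcases Nat.lt_succ_iff_lt_or_eq.mp hj with hj | rfl
      · exact h₄ j hj hjv hjm
      · exact absurd hjv hv

/-- The remaining work: the height of the stack, and for every node the possible increases of its
measure, weighted by its degree. -/
def potential (A : Arena n m) (f : Fin n → ℕ) (h : ℕ) : ℕ :=
  h + ∑ v, (A.top - f v) * (1 + 2 * entryCount A v (2 * m))

/-- A lift of `x` releases `1 + 2 * deg x`: one `deg x` covers the entries that the scan may push,
the rest pays for its time. -/
theorem potential_lift (x : Fin n) (hx : f x < A.top) :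
    potential A (Function.update f x (f x + 1)) h + (1 + 2 * entryCount A x (2 * m)) =
      potential A f h := by
  unfold potential
  rw [← Finset.add_sum_erase _ _ (Finset.mem_univ x), Function.update_self,
    ← Finset.add_sum_erase (a := x) Finset.univ (fun v => (A.top - f v) * _) (Finset.mem_univ x)]
  rw [Finset.sum_congr rfl fun v hv => by
    rw [Function.update_of_ne (Finset.ne_of_mem_erase hv)]]
  obtain ⟨d, hd⟩ := Nat.exists_eq_add_of_lt hx
  have h₁ : A.top - (f x + 1) = d := by omega
  have h₂ : A.top - f x = d + 1 := by omega
  rw [h₁, h₂]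
  ring

theorem goodness_update_of_forall_ne {x : Fin n} {z : ℕ} {k : Fin m} (h₁ : A.src k ≠ x)
    (h₂ : A.tgt k ≠ x) : A.goodness (Function.update f x z) k = A.goodness f k := by
  have : A.Good (Function.update f x z) k ↔ A.Good f k := by
    simp only [Arena.Good, Function.update_of_ne h₁, Function.update_of_ne h₂]
  unfold Arena.goodness
  by_cases hg : A.Good f k
  · rw [if_pos hg, if_pos (this.mpr hg)]
  · rw [if_neg hg, if_neg (this.not.mpr hg)]

theorem entryNode_two_mul (k : Fin m) : entryNode A (2 * k) = some (A.src k) := by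
  simp [entryNode]

theorem entryNode_two_mul_add_one (k : Fin m) : entryNode A (2 * k + 1) = some (A.tgt k) := by
  have h : (2 * (k : ℕ) + 1) / 2 = k := by omega
  simp [entryNode, h]

/-- The invariant of the main loop; `φ` pays for the remaining time. -/
def MainInvariant (A : Arena n m) (B H : ℕ) (P : (Fin n → ℕ) → Prop) (φ : ℕ) (s : Store) : Prop :=
  Static A B s ∧ ∃ f h, Dynamic A f (A.goodness f) h s ∧ (∀ v, f v ≤ A.top) ∧ P f ∧
    potential A f h ≤ H ∧ φ = 100 * potential A f h

/-- A lifted node stays on the stack; a node is popped only when it lacks nothing. So an empty stack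
means that nothing is left to lift. The predicate `P` is any property preserved by lifts; this keeps
games out of the analysis of the machine. -/
theorem halts_mainLoop (hN : Bounds A N H) {P : (Fin n → ℕ) → Prop}
    (hP : ∀ f x, P f → A.slack (A.goodness f) x < 0 → P (Function.update f x (f x + 1)))
    {φ : ℕ} (hs : MainInvariant A B H P φ s) :
    Halts N mainLoop s (φ + 2) fun s' => Static A B s' ∧
      ∃ f : Fin n → ℕ, (∀ v : Fin n, s'.arr 4 v = f v) ∧ (∀ v, f v ≤ A.top) ∧ P f ∧
        ∀ x, 0 ≤ A.slack (A.goodness f) x := by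
  have hlim := hN.limit
  have hedges := hN.edges
  refine (Halts.loop (MainInvariant A B H P) ?_ ?_ hs le_rfl).mono (by simp [Expr.cost]) ?_
  · rintro φ s ⟨hs, f, h, hd, hf, hPf, hH, rfl⟩
    have : h ≤ potential A f h := Nat.le_add_right _ _
    simp only [Expr.Fits, hd.height, abs_le]
    omega
  · rintro φ s ⟨hs, f, h, hd, hf, hPf, hH, rfl⟩ he
    have hhp : h ≤ potential A f h := Nat.le_add_right _ _
    simp only [Expr.eval, hd.height] at he
    obtain ⟨h, rfl⟩ : ∃ h', h = h' + 1 := ⟨h - 1, by omega⟩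
    obtain ⟨x, hx⟩ := hd.stack h (by omega)
    have h6 := hd.height
    have hidx : ((h + 1 : ℕ) : ℤ) - 1 = h := by push_cast; ring
    have hxn := x.2
    have hnH := hN.nodes
    have htop := hN.top
    have hfx := hf x
    have h9 := hd.slack x
    have h4 := hd.measure x
    have hsl := abs_le.mp (A.abs_slack_le (A.isBit_goodness f) x)
    obtain ⟨d, hcond⟩ : ∃ d, Halts N (.cond (.op .lt (.get 9 (.reg 7)) (.const 0))
        (.seq (.write 4 (.reg 7) (.op .add (.get 4 (.reg 7)) (.const 1))) <|
          .seq (.assign 8 (.get 5 (.reg 7))) scan)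
        (.assign 6 (.op .sub (.reg 6) (.const 1)))) (s.setReg 7 (x : ℕ)) d fun s' =>
          ∃ φ', MainInvariant A B H P φ' s' ∧ φ' + d + 20 ≤ 100 * potential A f (h + 1) := by
      have hfits : Expr.Fits N (s.setReg 7 (x : ℕ)) (.op .lt (.get 9 (.reg 7)) (.const 0)) := by
        simp only [Expr.Fits, Expr.eval, Op.eval, Store.reg_setReg, Store.arr_setReg, if_true, h9,
          abs_le]
        split_ifs <;> omega
      rcases lt_or_ge (A.slack (A.goodness f) x) 0 with hneg | hnn
      · refine ⟨80 * entryCount A x (2 * m) + 40, Halts.cond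
          (t₁ := 80 * entryCount A x (2 * m) + 30) hfits (fun _ => ?_) (fun hc => ?_)
          (by simp only [Expr.cost]; omega)⟩
        · have hlt := A.lt_top_of_slack_neg hf hneg
          have hpot := potential_lift (h := h + 1) x hlt
          set f' := Function.update f x (f x + 1) with hf'
          have hf'top : ∀ v, f' v ≤ A.top := fun v => by
            rw [hf', Function.update_apply]
            split_ifs
            · exact hlt
            · exact hf v
          refine Halts.write_seq (x : ℕ) (f x + 1 : ℕ) ?_ ?_ ?_ ?_
            (by simp only [Expr.cost]; omega) ?_
          · simp only [Expr.Fits, Store.reg_setReg, if_true, abs_le]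
            omega
          · simp only [Expr.Fits, Expr.eval, Op.eval, Store.reg_setReg, Store.arr_setReg, if_true, h4,
              abs_le]
            omega
          · simp [Expr.eval]
          · simp [Expr.eval, Op.eval, h4]
          have h5 := hs.head x
          have hlast := lastEntry_le (A := A) x (2 * m)
          refine Halts.assign_seq (lastEntry A x (2 * m) : ℕ) ?_ ?_
            (by simp only [Expr.cost]; omega) ?_
          · simp [Expr.Fits, Expr.eval, h5]
            omega
          · simp [Expr.eval, h5]
          have hge : h + 1 ≤ potential A f' (h + 1) := Nat.le_add_right _ _
          refine (halts_scan (B := B) (f := f') (ok := A.goodness f) (h := h + 1) hN hf'top x le_rfl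
            ?_ ?_ (A.isBit_goodness f) (by omega) (by simp)).mono ?_ ?_
          · constructor <;> simp [hs.reg_zero, hs.reg_one, hs.reg_four, hs.reg_five, hs.src, hs.tgt,
              hs.wt, hs.head]
            exact hs.next
          · constructor
            · intro v
              by_cases hv : v = x
              · simp [hv, hf']
              · simp [hv, hf', Fin.val_inj, hd.measure]
            · simpa using hd.bits
            · simpa using hd.slack
            · simpa using hd.height
            · simpa using hd.stack
            · simpa using hd.mem_stack
          · simp only [Expr.cost]
            omega
          · rintro s' ⟨hs', ok', h', hh', hd', -, hkeep, hnew⟩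
            -- Edges at `x` have been refreshed, and the others do not see the change of `f x`.
            have hok' : ok' = A.goodness f' := by
              funext k
              by_cases h₁ : A.src k = x
              · have := hnew (2 * k) (by omega) (by rw [entryNode_two_mul, h₁]) (by omega)
                simpa using this
              by_cases h₂ : A.tgt k = x
              · have hdiv : (2 * (k : ℕ) + 1) / 2 = k := by omega
                have := hnew (2 * k + 1) (by omega) (by rw [entryNode_two_mul_add_one, h₂]) (by omega)
                simpa [hdiv] using this
              exact hkeep k (goodness_update_of_forall_ne h₁ h₂).symm
            subst hok'
            have hpot' : potential A f' h' ≤ potential A f' (h + 1) + entryCount A x (2 * m) := by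
              unfold potential
              omega
            refine ⟨_, ⟨hs', f', h', hd', hf'top, hP f x hPf hneg, by omega, rfl⟩, ?_⟩
            omega
        · simp [Expr.eval, Op.eval, h9, hneg] at hc
      · refine ⟨20, Halts.cond (t₁ := 10) hfits (fun hc => ?_) (fun _ => ?_) (by decide)⟩
        · simp [Expr.eval, Op.eval, h9, hnn.not_gt] at hc
        · have hpot : potential A f (h + 1) = potential A f h + 1 := by
            unfold potential
            omega
          refine Halts.assign ?_ (by decide) ⟨100 * potential A f h,
            ⟨hs.congr (by intro j hj; simp; omega) (by simp), f, h, ?_, hf, hPf, by omega, rfl⟩, ?_⟩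
          · simp only [Expr.Fits, Expr.eval, Op.eval, Store.reg_setReg, Nat.reduceEqDiff, if_false,
              h6, hidx, abs_le]
            omega
          · constructor
            · simpa using hd.measure
            · simpa using hd.bits
            · simpa using hd.slack
            · simp only [Expr.eval, Op.eval, Store.reg_setReg, if_true, Nat.reduceEqDiff, if_false, h6,
                hidx]
            · intro i hi
              simpa using hd.stack i (by omega)
            · intro y hy
              obtain ⟨i, hi, hiy⟩ := hd.mem_stack y hy
              refine ⟨i, lt_of_le_of_ne (by omega) ?_, by simpa using hiy⟩
              rintro rfl
              rw [hx] at hiy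
              have : x = y := Fin.ext (by exact_mod_cast hiy)
              subst this
              omega
          · omega
    refine ⟨d + 10, Halts.assign_seq (x : ℕ) ?_ ?_ (by simp [Expr.cost])
      (hcond.mono (by simp [Expr.cost]) ?_)⟩
    · simp only [Expr.Fits, Expr.eval, Op.eval, h6, hidx, hx, abs_le]
      omega
    · simp only [Expr.eval, Op.eval, h6, hidx, hx]
    · rintro s' ⟨φ', h₁, h₂⟩
      refine ⟨φ', h₁, ?_⟩
      simp only [Expr.cost]
      omega
  · rintro s' ⟨⟨φ', hs, f, h, hd, hf, hPf, hH, rfl⟩, he⟩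
    simp only [Expr.eval, hd.height] at he
    refine ⟨hs, f, hd.measure, hf, hPf, fun x => ?_⟩
    by_contra hc
    obtain ⟨i, hi, -⟩ := hd.mem_stack x (not_le.mp hc)
    omega

end RAM

/-! ### Initialization, output and the complete program -/

namespace RAM

/-- Compute the rounded weight of the edge in register `8`; edges count as good for Bob and as bad
for Alice at first. -/
def setupEdge : Program :=
  .seq (.write 7 (.reg 8)
    (.op .sub (.const 0) (.op .div (.op .sub (.const 0) (.get 2 (.reg 8))) (.reg 4)))) <|
  .write 8 (.reg 8) (.op .sub (.const 1) (.get 3 (.get 0 (.reg 8))))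

/-- Initialize the slack of the node in register `8`, and push it. -/
def setupNode : Program :=
  .seq (.write 9 (.reg 8) (.op .sub (.const 0) (.get 3 (.reg 8)))) <|
  .write 10 (.reg 8) (.reg 8)

/-- Put the entry in register `8` in front of the incidence list of its node. -/
def setupEntry : Program :=
  .seq (.assign 9 (.op .div (.reg 8) (.const 2))) <|
  .seq (.cond (.op .sub (.reg 8) (.op .mul (.const 2) (.reg 9)))
    (.assign 10 (.get 1 (.reg 9))) (.assign 10 (.get 0 (.reg 9)))) <|
  .seq (.write 6 (.reg 8) (.get 5 (.reg 10))) <|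
  .write 5 (.reg 10) (.op .add (.reg 8) (.const 1))

/-- Convert the measure of the node in register `8` to its energy. -/
def outputNode : Program :=
  .cond (.op .lt (.get 4 (.reg 8)) (.reg 5))
    (.write 4 (.reg 8) (.op .mul (.get 4 (.reg 8)) (.reg 4))) (.write 4 (.reg 8) (.const (-1)))

/-- The part of the program after the computation of `B` and of the measure that stands for `∞`. -/
def solveArena : Program :=
  .seq (forLoop (.reg 1) setupEdge) <|
  .seq (forLoop (.reg 0) setupNode) <|
  .seq (forLoop (.op .add (.reg 1) (.reg 1)) setupEntry) <|
  .seq (.assign 6 (.reg 0)) <|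
  .seq (forLoop (.reg 1) (.seq (.assign 9 (.reg 8)) refresh)) <|
  .seq mainLoop <|
  forLoop (.reg 0) outputNode

/-- The program that computes the minimal energy of the rounded weights. -/
def solve : Program :=
  .seq (.assign 4 (.op .div (.reg 3) (.reg 0))) <|
  .seq (.assign 5 (.op .add (.op .div (.reg 2) (.reg 4)) (.const 1))) solveArena

variable {n m : ℕ} (A : Arena n m)

open Classical in
/-- The initial guess which edges are good. -/
def initialBits (k : Fin m) : ℤ := if A.src k ∈ A.alice then 0 else 1

open Classical in
/-- The store during the initialization, after `i₁` edges, `i₂` nodes and `i₃` entries of the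
incidence lists; `w` are the weights before rounding. -/
structure Setup (w : Fin m → ℤ) (B i₁ i₂ i₃ : ℕ) (s : Store) : Prop where
  reg_zero : s.reg 0 = n
  reg_one : s.reg 1 = m
  reg_four : s.reg 4 = B
  reg_five : s.reg 5 = A.top
  src : ∀ k : Fin m, s.arr 0 k = (A.src k : ℕ)
  tgt : ∀ k : Fin m, s.arr 1 k = (A.tgt k : ℕ)
  weight : ∀ k : Fin m, s.arr 2 k = w k
  owner : ∀ v : Fin n, s.arr 3 v = if v ∈ A.alice then 1 else 0
  measure : ∀ v : Fin n, s.arr 4 v = 0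
  wt : ∀ k : Fin m, (k : ℕ) < i₁ → s.arr 7 k = A.wt k
  bits : ∀ k : Fin m, (k : ℕ) < i₁ → s.arr 8 k = initialBits A k
  slack : ∀ v : Fin n, (v : ℕ) < i₂ → s.arr 9 v = A.slack (initialBits A) v
  stack : ∀ v : Fin n, (v : ℕ) < i₂ → s.arr 10 v = (v : ℕ)
  head : ∀ v : Fin n, s.arr 5 v = lastEntry A v i₃
  next : ∀ j < i₃, ∀ v, entryNode A j = some v → s.arr 6 j = lastEntry A v j

variable {A} {w : Fin m → ℤ} {B N H h i₁ i₂ i₃ : ℕ} {f : Fin n → ℕ} {ok : Fin m → ℤ} {s : Store}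

theorem isBit_initialBits : Arena.IsBit (initialBits A) := fun k => by
  unfold initialBits
  split_ifs <;> simp

-- With this guess the slack does not depend on the degree, so it can be written down in constant
-- time per node. `refresh` then corrects the guess edge by edge.
open Classical in
theorem slack_initialBits (v : Fin n) :
    A.slack (initialBits A) v = if v ∈ A.alice then -1 else 0 := by
  unfold Arena.slack
  split_ifs with hv
  · rw [Finset.sum_eq_zero]
    · rfl
    · intro k hk
      simp only [Finset.mem_filter, Finset.mem_univ, true_and] at hk
      simp [initialBits, hk, hv]
  · refine Finset.sum_eq_zero fun k hk => ?_
    simp only [Finset.mem_filter, Finset.mem_univ, true_and] at hk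
    simp [initialBits, hk, hv]

theorem Setup.setReg (hs : Setup A w B i₁ i₂ i₃ s) {i : ℕ} (hi : 6 ≤ i) (z : ℤ) :
    Setup A w B i₁ i₂ i₃ (s.setReg i z) := by
  constructor <;> simp only [Store.reg_setReg, Store.arr_setReg]
  · rw [if_neg (by omega), hs.reg_zero]
  · rw [if_neg (by omega), hs.reg_one]
  · rw [if_neg (by omega), hs.reg_four]
  · rw [if_neg (by omega), hs.reg_five]
  exacts [hs.src, hs.tgt, hs.weight, hs.owner, hs.measure, hs.wt, hs.bits, hs.slack, hs.stack,
    hs.head, hs.next]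

theorem halts_setupEdge (hN : Bounds A N H) (hw : ∀ k, |w k| ≤ H) (hB : B ≤ H)
    (hwt : ∀ k, A.wt k = 0 - (0 - w k) / B) {i : ℕ} (hi : i < m)
    (hs : Setup A w B i i₂ i₃ s) (h8 : s.reg 8 = i) :
    Halts N setupEdge s 30 fun s' => Setup A w B (i + 1) i₂ i₃ s' ∧ s'.reg 8 = i := by
  classical
  obtain ⟨hN1, hN2, hN3, hN4, hN5⟩ := hN
  have h4 := hs.reg_four
  have h0 := hs.src ⟨i, hi⟩
  have h2 := hs.weight ⟨i, hi⟩
  have h3 := hs.owner (A.src ⟨i, hi⟩)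
  have hwi := abs_le.mp (hw ⟨i, hi⟩)
  have hwti := abs_le.mp (hN5 ⟨i, hi⟩)
  have hwi' := hwt ⟨i, hi⟩
  have hx := (A.src ⟨i, hi⟩).2
  simp only at h0 h2
  refine Halts.write_seq (i : ℕ) (A.wt ⟨i, hi⟩) ?_ ?_ ?_ ?_ (by decide) ?_
  · simp only [Expr.Fits, h8, abs_le]
    omega
  · simp only [Expr.Fits, Expr.eval, Op.eval, h8, h4, h2, abs_le]
    omega
  · simp [Expr.eval, h8]
  · simp only [Expr.eval, Op.eval, h8, h4, h2, hwi']
  refine Halts.write ?_ ?_ (by decide) ⟨?_, by simp [h8]⟩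
  · simp only [Expr.Fits, Store.reg_setArr, h8, abs_le]
    omega
  · simp [Expr.Fits, Expr.eval, Op.eval, h8, h0, h3, abs_le]
    split_ifs <;> omega
  · have hbit : (1 : ℤ) - (if A.src ⟨i, hi⟩ ∈ A.alice then 1 else 0) = initialBits A ⟨i, hi⟩ := by
      unfold initialBits
      split_ifs <;> rfl
    constructor
    case wt =>
      intro k hk
      by_cases hki : (k : ℕ) = i
      · subst hki
        simp
      · simp [hki, hs.wt k (by omega)]
    case bits =>
      intro k hk
      by_cases hki : (k : ℕ) = i
      · subst hki
        simpa [Expr.eval, Op.eval, h8, h0, h3] using hbit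
      · simp [Expr.eval, h8, hki, hs.bits k (by omega)]
    all_goals simp only [Store.reg_setArr, Store.arr_setArr, Nat.reduceEqDiff, false_and, if_false]
    exacts [hs.reg_zero, hs.reg_one, hs.reg_four, hs.reg_five, hs.src, hs.tgt, hs.weight, hs.owner,
      hs.measure, hs.slack, hs.stack, hs.head, hs.next]

theorem halts_setupNode (hN : Bounds A N H) {i : ℕ} (hi : i < n)
    (hs : Setup A w B i₁ i i₃ s) (h8 : s.reg 8 = i) :
    Halts N setupNode s 30 fun s' => Setup A w B i₁ (i + 1) i₃ s' ∧ s'.reg 8 = i := by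
  classical
  obtain ⟨hN1, hN2, hN3, hN4, hN5⟩ := hN
  have h3 := hs.owner ⟨i, hi⟩
  simp only at h3
  refine Halts.write_seq (i : ℕ) (A.slack (initialBits A) ⟨i, hi⟩) ?_ ?_ ?_ ?_ (by decide) ?_
  · simp only [Expr.Fits, h8, abs_le]
    omega
  · simp only [Expr.Fits, Expr.eval, Op.eval, h8, h3, abs_le]
    split_ifs <;> omega
  · simp [Expr.eval, h8]
  · simp only [Expr.eval, Op.eval, h8, h3, slack_initialBits]
    split_ifs <;> rfl
  refine Halts.write ?_ ?_ (by decide) ⟨?_, by simp [h8]⟩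
  · simp only [Expr.Fits, Store.reg_setArr, h8, abs_le]
    omega
  · simp only [Expr.Fits, Store.reg_setArr, h8, abs_le]
    omega
  · constructor
    case slack =>
      intro k hk
      by_cases hki : (k : ℕ) = i
      · subst hki
        simp
      · simp [hki, hs.slack k (by omega)]
    case stack =>
      intro k hk
      by_cases hki : (k : ℕ) = i
      · subst hki
        simp [Expr.eval, h8]
      · simp [Expr.eval, h8, hki, hs.stack k (by omega)]
    all_goals simp only [Store.reg_setArr, Store.arr_setArr, Nat.reduceEqDiff, false_and, if_false]
    exacts [hs.reg_zero, hs.reg_one, hs.reg_four, hs.reg_five, hs.src, hs.tgt, hs.weight, hs.owner,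
      hs.measure, hs.wt, hs.bits, hs.head, hs.next]

theorem halts_setupEntry (hN : Bounds A N H) {i : ℕ} (hi : i < 2 * m)
    (hs : Setup A w B i₁ i₂ i s) (h8 : s.reg 8 = i) :
    Halts N setupEntry s 40 fun s' => Setup A w B i₁ i₂ (i + 1) s' ∧ s'.reg 8 = i := by
  classical
  obtain ⟨hN1, hN2, hN3, hN4, hN5⟩ := hN
  have him : i / 2 < m := by omega
  have h0 := hs.src ⟨i / 2, him⟩
  have h1 := hs.tgt ⟨i / 2, him⟩
  have hx := (A.src ⟨i / 2, him⟩).2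
  have hy := (A.tgt ⟨i / 2, him⟩).2
  simp only at h0 h1
  obtain ⟨v, hv⟩ : ∃ v, entryNode A i = some v := by simp [entryNode, him]
  have hv' : v = if i % 2 = 0 then A.src ⟨i / 2, him⟩ else A.tgt ⟨i / 2, him⟩ := by
    simpa [entryNode, him] using hv.symm
  have hvn := v.2
  have h5 := hs.head v
  have hlast := lastEntry_le (A := A) v i
  refine Halts.assign_seq (i / 2 : ℕ) ?_ ?_ (by decide) ?_
  · simp only [Expr.Fits, Expr.eval, Op.eval, h8, abs_le]
    omega
  · simp [Expr.eval, Op.eval, h8]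
  -- The condition is the parity of `i`, computed as `i - 2 * (i / 2)`.
  have key : Halts N (.cond (.op .sub (.reg 8) (.op .mul (.const 2) (.reg 9)))
      (.assign 10 (.get 1 (.reg 9))) (.assign 10 (.get 0 (.reg 9)))) (s.setReg 9 (i / 2 : ℕ)) 12
      fun s' => s' = (s.setReg 9 (i / 2 : ℕ)).setReg 10 (v : ℕ) := by
    refine Halts.cond (t₁ := 3) ?_ ?_ ?_ (by decide)
    · simp only [Expr.Fits, Expr.eval, Op.eval, Store.reg_setReg, Nat.reduceEqDiff, if_true,
        if_false, h8, abs_le]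
      omega
    · intro hne
      simp only [Expr.eval, Op.eval, Store.reg_setReg, Nat.reduceEqDiff, if_true,
        if_false, h8] at hne
      refine Halts.assign ?_ (by decide) ?_
      · simp only [Expr.Fits, Expr.eval, Store.reg_setReg, Store.arr_setReg, if_true, h1, abs_le]
        omega
      · rw [hv', if_neg (by omega)]
        simp only [Expr.eval, Store.reg_setReg, Store.arr_setReg, if_true, h1]
    · intro heq
      simp only [Expr.eval, Op.eval, Store.reg_setReg, Nat.reduceEqDiff, if_true,
        if_false, h8] at heq
      refine Halts.assign ?_ (by decide) ?_
      · simp only [Expr.Fits, Expr.eval, Store.reg_setReg, Store.arr_setReg, if_true, h0, abs_le]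
        omega
      · rw [hv', if_pos (by omega)]
        simp only [Expr.eval, Store.reg_setReg, Store.arr_setReg, if_true, h0]
  refine Halts.seq (t₁ := 12) (t₂ := 20) (key.mono le_rfl ?_) (by decide)
  rintro s' rfl
  refine Halts.write_seq (i : ℕ) (lastEntry A v i) ?_ ?_ ?_ ?_ (by decide) ?_
  · simp [Expr.Fits, h8]
    omega
  · simp [Expr.Fits, Expr.eval, h5]
    omega
  · simp [Expr.eval, h8]
  · simp [Expr.eval, h5]
  refine Halts.write ?_ ?_ (by decide) ⟨?_, by simp [h8]⟩
  · simp [Expr.Fits]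
    omega
  · simp [Expr.Fits, Expr.eval, Op.eval, h8, abs_le]
    omega
  · constructor
    case head =>
      intro u
      by_cases hu : u = v
      · simp [Expr.eval, Op.eval, h8, hu, lastEntry, hv]
      · simp [Expr.eval, hu, Fin.val_inj, lastEntry, hv, Ne.symm hu, hs.head]
    case next =>
      intro j hj u hu
      by_cases hji : j = i
      · subst hji
        rw [hv, Option.some.injEq] at hu
        simp [hu]
      · simp [hji, hs.next j (by omega) u hu]
    all_goals simp only [Store.reg_setArr, Store.arr_setArr, Store.reg_setReg, Store.arr_setReg,
      Nat.reduceEqDiff, false_and, if_false, OfNat.zero_ne_ofNat, OfNat.one_ne_ofNat]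
    exacts [hs.reg_zero, hs.reg_one, hs.reg_four, hs.reg_five, hs.src, hs.tgt, hs.weight, hs.owner,
      hs.measure, hs.wt, hs.bits, hs.slack, hs.stack]

theorem halts_setup (hN : Bounds A N H) (hw : ∀ k, |w k| ≤ H) (hB : B ≤ H)
    (hwt : ∀ k, A.wt k = 0 - (0 - w k) / B) (hs : Setup A w B 0 0 0 s) {p : Program} {t : ℕ}
    {Q : Store → Prop} (hp : ∀ s', Setup A w B m n (2 * m) s' → Halts N p s' t Q) :
    Halts N (.seq (forLoop (.reg 1) setupEdge) <| .seq (forLoop (.reg 0) setupNode) <|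
      .seq (forLoop (.op .add (.reg 1) (.reg 1)) setupEntry) p) s
      ((m + 1) * 41 + ((n + 1) * 41 + ((2 * m + 1) * 53 + t))) Q := by
  have h₁ := hN.limit
  have h₂ := hN.nodes
  have h₃ := hN.edges
  have step₁ : Halts N (forLoop (.reg 1) setupEdge) s ((m + 1) * 41) (Setup A w B m 0 0) := by
    refine Halts.forLoop (I := fun i => Setup A w B i 0 0) (d := 30) (by omega) ?_ ?_ ?_ hs le_rfl
    · intro i s hs
      refine ⟨?_, hs.reg_one⟩
      simp only [Expr.Fits, hs.reg_one, abs_le]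
      omega
    · exact fun i s z hs => hs.setReg (by omega) z
    · exact fun i hi s hs h8 => halts_setupEdge hN hw hB hwt hi hs h8
  have step₂ : ∀ s, Setup A w B m 0 0 s →
      Halts N (forLoop (.reg 0) setupNode) s ((n + 1) * 41) (Setup A w B m n 0) := by
    intro s hs
    refine Halts.forLoop (I := fun i => Setup A w B m i 0) (d := 30) (by omega) ?_ ?_ ?_ hs le_rfl
    · intro i s hs
      refine ⟨?_, hs.reg_zero⟩
      simp only [Expr.Fits, hs.reg_zero, abs_le]
      omega
    · exact fun i s z hs => hs.setReg (by omega) z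
    · exact fun i hi s hs h8 => halts_setupNode hN hi hs h8
  have step₃ : ∀ s, Setup A w B m n 0 s →
      Halts N (forLoop (.op .add (.reg 1) (.reg 1)) setupEntry) s ((2 * m + 1) * 53)
        (Setup A w B m n (2 * m)) := by
    intro s hs
    refine Halts.forLoop (I := fun i => Setup A w B m n i) (d := 40) (by omega) ?_ ?_ ?_ hs le_rfl
    · intro i s hs
      refine ⟨?_, ?_⟩
      · simp only [Expr.Fits, Expr.eval, Op.eval, hs.reg_one, abs_le]
        omega
      · simp only [Expr.eval, Op.eval, hs.reg_one]
        push_cast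
        ring
    · exact fun i s z hs => hs.setReg (by omega) z
    · exact fun i hi s hs h8 => halts_setupEntry hN hi hs h8
  exact Halts.seq (step₁.mono le_rfl fun _ h => Halts.seq ((step₂ _ h).mono le_rfl fun _ h =>
    Halts.seq ((step₃ _ h).mono le_rfl hp) le_rfl) le_rfl) le_rfl

theorem Setup.static (hs : Setup A w B m n (2 * m) s) : Static A B s where
  reg_zero := hs.reg_zero
  reg_one := hs.reg_one
  reg_four := hs.reg_four
  reg_five := hs.reg_five
  src := hs.src
  tgt := hs.tgt
  wt k := hs.wt k k.2
  head := hs.head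
  -- Entries from `2 * m` on belong to no node.
  next j v hv := hs.next j (by
    by_contra hc
    have : ¬ j / 2 < m := by omega
    simp [entryNode, this] at hv) v hv

/-- All nodes are on the stack at first, so its completeness is immediate. -/
theorem Setup.dynamic (hs : Setup A w B m n i₃ s) (h6 : s.reg 6 = n) :
    Dynamic A (fun _ => 0) (initialBits A) n s where
  measure := hs.measure
  bits k := hs.bits k k.2
  slack v := hs.slack v v.2
  height := h6
  stack i hi := ⟨⟨i, hi⟩, hs.stack ⟨i, hi⟩ hi⟩
  mem_stack x _ := ⟨x, x.2, hs.stack x x.2⟩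

theorem halts_refreshAll (hN : Bounds A N H) (hf : ∀ v, f v ≤ A.top) (hh : h + m ≤ H)
    (hs : Static A B s) (hd : Dynamic A f ok h s) (hok : Arena.IsBit ok) :
    Halts N (forLoop (.reg 1) (.seq (.assign 9 (.reg 8)) refresh)) s ((m + 1) * 81) fun s' =>
      Static A B s' ∧ ∃ h' ≤ h + m, Dynamic A f (A.goodness f) h' s' := by
  have hlim := hN.limit
  have hedges := hN.edges
  refine (Halts.forLoop (I := fun i s => Static A B s ∧ ∃ h' ≤ h + i, ∃ ok, Arena.IsBit ok ∧
    Dynamic A f ok h' s ∧ ∀ k : Fin m, (k : ℕ) < i → ok k = A.goodness f k) (K := m) (d := 70)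
    (by omega) ?_ ?_ ?_ ⟨hs, h, le_rfl, ok, hok, hd, by simp⟩ le_rfl).mono le_rfl ?_
  · rintro i s ⟨hs, -⟩
    refine ⟨?_, hs.reg_one⟩
    simp only [Expr.Fits, hs.reg_one, abs_le]
    omega
  · rintro i s z ⟨hs, h', hh', ok, hok, hd, hk⟩
    exact ⟨hs.congr (by intro j hj; simp; omega) (by simp), h', hh', ok, hok,
      hd.congr (by simp) (by simp), hk⟩
  · rintro i hi s ⟨hs, h', hh', ok, hok, hd, hk⟩ h8
    refine Halts.assign_seq (i : ℕ) ?_ h8 (by decide) ?_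
    · simp only [Expr.Fits, h8, abs_le]
      omega
    refine (halts_refresh hN (k := ⟨i, hi⟩) (hs.congr (by intro j hj; simp; omega) (by simp))
      (hd.congr (by simp) (by simp)) hok hf (by omega) (by simp)).mono (by decide) ?_
    rintro s' ⟨hs8, hs', h'', hh'', hd'⟩
    refine ⟨⟨hs', h'', by omega, _, isBit_update hok _, hd', fun k hk' => ?_⟩, by simpa [h8] using hs8⟩
    by_cases hki : k = ⟨i, hi⟩
    · simp [hki]
    · rw [Function.update_of_ne hki]
      exact hk k (lt_of_le_of_ne (by omega) fun h => hki (Fin.ext h))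
  · rintro s' ⟨hs', h', hh', ok', -, hd', hk⟩
    have : ok' = A.goodness f := funext fun k => hk k k.2
    exact ⟨hs', h', hh', this ▸ hd'⟩

theorem halts_output (hN : Bounds A N H) (hB : B ≤ H) (htop : ∀ x < A.top, x * B ≤ H)
    (hf : ∀ v, f v ≤ A.top) (hs : Static A B s) (hd : ∀ v : Fin n, s.arr 4 v = f v) :
    Halts N (forLoop (.reg 0) outputNode) s ((n + 1) * 41) fun s' =>
      ∀ v : Fin n, s'.arr 4 v = if f v < A.top then (f v * B : ℤ) else -1 := by
  have hlim := hN.limit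
  have hnodes := hN.nodes
  have htopH := hN.top
  refine (Halts.forLoop (I := fun i s => (s.reg 0 = n ∧ s.reg 4 = B ∧ s.reg 5 = A.top) ∧
    -- The conversion is done in place: cells below `i` hold energies, the others still measures.
    ∀ v : Fin n, s.arr 4 v = if (v : ℕ) < i then (if f v < A.top then (f v * B : ℤ) else -1)
      else f v) (K := n) (d := 30)
    (by omega) ?_ ?_ ?_ ⟨⟨hs.reg_zero, hs.reg_four, hs.reg_five⟩, by simpa using hd⟩
    le_rfl).mono le_rfl ?_
  · rintro i s ⟨⟨h0, -⟩, -⟩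
    refine ⟨?_, h0⟩
    simp only [Expr.Fits, h0, abs_le]
    omega
  · rintro i s z ⟨h, ha⟩
    exact ⟨by simpa using h, by simpa using ha⟩
  · rintro i hi s ⟨⟨h0, h4, h5⟩, ha⟩ h8
    have ha4 := ha ⟨i, hi⟩
    simp only [lt_irrefl, if_false] at ha4
    have hfi := hf ⟨i, hi⟩
    have hpost : ∀ z, z = (if f ⟨i, hi⟩ < A.top then (f ⟨i, hi⟩ * B : ℤ) else -1) → ∀ v : Fin n,
        (s.setArr 4 (i : ℕ) z).arr 4 v = if (v : ℕ) < i + 1 then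
          (if f v < A.top then (f v * B : ℤ) else -1) else f v := by
      rintro z rfl v
      by_cases hv : (v : ℕ) = i
      · subst hv
        simp
      · have : (v : ℕ) < i + 1 ↔ (v : ℕ) < i := by omega
        simp only [Store.arr_setArr, true_and, Nat.cast_inj, hv, if_false, this, ha]
    refine Halts.cond (t₁ := 10) ?_ ?_ ?_ (by decide)
    · simp only [Expr.Fits, Expr.eval, Op.eval, h8, ha4, h5, abs_le]
      split_ifs <;> omega
    · intro hlt
      simp only [Expr.eval, Op.eval, h8, ha4, h5, Nat.cast_lt, ne_eq, ite_eq_right_iff,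
        one_ne_zero, imp_false, not_not] at hlt
      have hprod : ((f ⟨i, hi⟩ : ℤ) * B) ≤ H := by exact_mod_cast htop _ hlt
      have hprod' : 0 ≤ (f ⟨i, hi⟩ : ℤ) * B := by positivity
      refine Halts.write ?_ ?_ (by decide) ⟨⟨⟨h0, h4, h5⟩, ?_⟩, h8⟩
      · simp only [Expr.Fits, h8, abs_le]
        omega
      · simp only [Expr.Fits, Expr.eval, Op.eval, h8, ha4, h4, abs_le]
        omega
      · simp only [Expr.eval, Op.eval, h8, ha4, h4]
        exact hpost _ (by rw [if_pos hlt])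
    · intro hge
      simp only [Expr.eval, Op.eval, h8, ha4, h5, Nat.cast_lt, ite_eq_right_iff,
        one_ne_zero, imp_false] at hge
      refine Halts.write ?_ ?_ (by decide) ⟨⟨⟨h0, h4, h5⟩, ?_⟩, h8⟩
      · simp only [Expr.Fits, h8, abs_le]
        omega
      · simp only [Expr.Fits, abs_le]
        omega
      · simp only [Expr.eval, h8]
        exact hpost _ (by rw [if_neg hge])
  · rintro s' ⟨-, ha⟩ v
    rw [ha, if_pos v.2]

theorem halts_solveArena (hN : Bounds A N H) (hw : ∀ k, |w k| ≤ H) (hB : B ≤ H)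
    (hwt : ∀ k, A.wt k = 0 - (0 - w k) / B) (htop : ∀ x < A.top, x * B ≤ H)
    (hH : potential A (fun _ => 0) (n + m) ≤ H) {P : (Fin n → ℕ) → Prop} (h₀ : P fun _ => 0)
    (hP : ∀ f x, P f → A.slack (A.goodness f) x < 0 → P (Function.update f x (f x + 1)))
    (hs : Setup A w B 0 0 0 s) :
    Halts N solveArena s (400 * (potential A (fun _ => 0) (n + m) + 1)) fun s' =>
      ∃ f : Fin n → ℕ, P f ∧ (∀ x, 0 ≤ A.slack (A.goodness f) x) ∧
        ∀ v : Fin n, s'.arr 4 v = if f v < A.top then (f v * B : ℤ) else -1 := by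
  have hlim := hN.limit
  have hnodes := hN.nodes
  have hpot : n + m ≤ potential A (fun _ => 0) (n + m) := Nat.le_add_right _ _
  refine (halts_setup (t := 2 + ((m + 1) * 81 +
    (100 * potential A (fun _ => 0) (n + m) + 2 + (n + 1) * 41))) hN hw hB hwt hs ?_).mono
    (by omega) fun _ h => h
  intro s hs
  refine Halts.seq (t₁ := 2) (Halts.assign ?_ (by decide) ?_) le_rfl
  · simp only [Expr.Fits, hs.reg_zero, abs_le]
    omega
  have hs' := hs.setReg (i := 6) le_rfl ((Expr.reg 0).eval s)
  refine Halts.seq ((halts_refreshAll hN (fun _ => Nat.zero_le _) (by omega) hs'.static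
    (hs'.dynamic (by simp [Expr.eval, hs.reg_zero])) isBit_initialBits).mono le_rfl ?_) le_rfl
  rintro s₁ ⟨hs₁, h, hh, hd⟩
  have hle : potential A (fun _ => 0) h ≤ potential A (fun _ => 0) (n + m) :=
    Nat.add_le_add_right hh _
  refine Halts.seq (t₁ := 100 * potential A (fun _ => 0) (n + m) + 2) ((halts_mainLoop hN hP
    ⟨hs₁, _, h, hd, fun _ => Nat.zero_le _, h₀, by omega, rfl⟩).mono (by omega) ?_) le_rfl
  rintro s₂ ⟨hs₂, f, hd₂, hf, hPf, hsl⟩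
  exact (halts_output hN hB htop hf hs₂ hd₂).mono le_rfl fun s₃ h => ⟨f, hPf, hsl, h⟩

theorem potential_zero_le (A : Arena n m) (h : ℕ) :
    potential A (fun _ => 0) h ≤ h + A.top * (n + 4 * m) := by
  have h₁ := sum_entryCount_le (A := A) (2 * m)
  simp only [potential, Nat.sub_zero, ← Finset.mul_sum, Finset.sum_add_distrib]
  simp only [Finset.sum_const, Finset.card_univ, Fintype.card_fin, smul_eq_mul, mul_one]
  exact Nat.add_le_add_left (Nat.mul_le_mul_left _ (by omega)) _

end RAM

/-! ### Word size, total time and the theorem -/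

namespace GameGraph

variable {n m : ℕ} {G : GameGraph (Fin n)}

theorem card_nodes_le (edges : Fin m ≃ G.Edge) : n ≤ m := by
  have hs := (Arena.ofGraph G edges (fun _ _ => 0) 0).exists_src
  simpa using Fintype.card_le_of_surjective _ hs

theorem card_edges_le (edges : Fin m ≃ G.Edge) : m ≤ n * n := by
  simpa using Fintype.card_le_of_injective (fun k => (edges k).1)
    (Subtype.val_injective.comp edges.injective)

end GameGraph

namespace RAM

variable {n m : ℕ} {G : GameGraph (Fin n)} {w : Fin n → Fin n → ℤ} {edges : Fin m ≃ G.Edge}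
  {M c : ℕ}

theorem ofFin_val {k : ℕ} (f : Fin k → ℤ) (i : Fin k) : ofFin f (i : ℕ) = f i := by
  simp [ofFin]

/-- The arena for the weights that are rounded up to multiples of `B`, in units of `B`. -/
abbrev roundedArena (G : GameGraph (Fin n)) (w : Fin n → Fin n → ℤ) (edges : Fin m ≃ G.Edge)
    (M B : ℕ) : Arena n m :=
  Arena.ofGraph G edges (fun u v => 0 - (0 - w u v) / B) (M / B + 1)

open Classical in
theorem setup_inputStore (B : ℕ) :
    Setup (roundedArena G w edges M B) (fun k => w (edges k).1.1 (edges k).1.2) B 0 0 0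
      (((inputStore G w edges M c).setReg 4 B).setReg 5 (M / B + 1 : ℕ)) := by
  constructor <;> simp only [Store.reg_setReg, Store.arr_setReg, Nat.reduceEqDiff, if_true, if_false,
    OfNat.zero_ne_ofNat, OfNat.one_ne_ofNat, Nat.not_lt_zero, false_implies, implies_true,
    lastEntry]
  · rfl
  · rfl
  · rfl
  · exact fun k => ofFin_val (fun k : Fin m => ((edges k).1.1.val : ℤ)) k
  · exact fun k => ofFin_val (fun k : Fin m => ((edges k).1.2.val : ℤ)) k
  · exact fun k => ofFin_val (fun k : Fin m => w (edges k).1.1 (edges k).1.2) k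
  · exact fun v => ofFin_val (fun v : Fin n => if v ∈ G.alice then 1 else 0) v
  · exact fun v => rfl
  · exact fun v => rfl

theorem abs_weight_le (k : Fin m) : |w (edges k).1.1 (edges k).1.2| ≤ maxWeight G w edges := by
  rw [Int.abs_eq_natAbs]
  exact_mod_cast Finset.le_sup (f := fun k => (w (edges k).1.1 (edges k).1.2).natAbs)
    (Finset.mem_univ k)

/-- A bound on the numbers that occur in the computation. -/
def wordBound (n m M c W : ℕ) : ℕ := (n + m) + (M + 1) * (n + 4 * m) + M + c + W + 1

/-- With `X = n + M + c + W + 2`, `m ≤ n * n` makes the numbers at most cubic in `X`. As `X ≥ 4`, a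
factor `X ^ 3 ≥ 64` absorbs the constants, hence the exponent `6`. -/
theorem four_mul_wordBound_le {W : ℕ} (hm : m ≤ n * n) (hn : 0 < n) (hc : 0 < c) :
    4 * wordBound n m M c W + 8 ≤ (n + M + c + W + 2) ^ 6 := by
  obtain ⟨X, hX⟩ : ∃ X, X = n + M + c + W + 2 := ⟨_, rfl⟩
  have hX4 : 4 ≤ X := by omega
  have h₁ : m ≤ X ^ 2 := hm.trans (by rw [sq]; exact Nat.mul_le_mul (by omega) (by omega))
  have h₂ : (M + 1) * (n + 4 * m) ≤ X * (X + 4 * X ^ 2) :=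
    Nat.mul_le_mul (by omega) (by omega)
  have h₃ : 4 * X ≤ X ^ 2 := by nlinarith
  have h₄ : 4 * X ^ 2 ≤ X ^ 3 := by nlinarith [sq_nonneg X]
  have h₅ : 64 * X ^ 3 ≤ X ^ 6 := by
    have : 4 ^ 3 ≤ X ^ 3 := Nat.pow_le_pow_left hX4 3
    calc 64 * X ^ 3 = 4 ^ 3 * X ^ 3 := by norm_num
      _ ≤ X ^ 3 * X ^ 3 := Nat.mul_le_mul_right _ this
      _ = X ^ 6 := by ring
  rw [← hX]
  have h₆ : X * (X + 4 * X ^ 2) = X ^ 2 + 4 * X ^ 3 := by ring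
  unfold wordBound
  omega

theorem halts_solve (hn : 0 < n) (hc : n ≤ c)
    (hM : G.IsFiniteEnergyBound (GameGraph.roundUp (c / n) w) M) :
    Halts ((n + M + c + maxWeight G w edges + 2) ^ 6) solve (inputStore G w edges M c)
      (400 * (n + m + (M / (c / n) + 1) * (n + 4 * m)) + 420)
      fun s => Outputs s fun v => G.minEnergy (GameGraph.roundUp (c / n) w) v := by
  have hB : 0 < c / n := Nat.div_pos hc hn
  have hBc : c / n ≤ c := Nat.div_le_self c n
  obtain ⟨B, hBdef⟩ : ∃ B, B = c / n := ⟨_, rfl⟩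
  rw [← hBdef] at hB hBc hM ⊢
  obtain ⟨W, hW⟩ : ∃ W, W = maxWeight G w edges := ⟨_, rfl⟩
  have hlim := four_mul_wordBound_le (M := M) (W := W) (GameGraph.card_edges_le edges) hn
    (hn.trans_le hc)
  rw [← hW]
  set N := (n + M + c + W + 2) ^ 6
  set H := wordBound n m M c W with hH
  have hdiv : M / B ≤ M := Nat.div_le_self M B
  have hHdef : H = (n + m) + (M + 1) * (n + 4 * m) + M + c + W + 1 := rfl
  have hprod : n + 4 * m ≤ (M + 1) * (n + 4 * m) := Nat.le_mul_of_pos_left _ (Nat.succ_pos M)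
  set A := roundedArena G w edges M B with hA
  have htopdef : A.top = M / B + 1 := rfl
  have hw : ∀ k, |w (edges k).1.1 (edges k).1.2| ≤ W := fun k => hW ▸ abs_weight_le k
  have hN : Bounds A N H := by
    refine ⟨hlim, by omega, by omega, by omega, fun k => ?_⟩
    have h₁ : |(0 - w (edges k).1.1 (edges k).1.2) / (B : ℤ)| ≤ W :=
      (Int.abs_ediv_le_abs _ _).trans (by simpa using hw k)
    have h₂ : A.wt k = -((0 - w (edges k).1.1 (edges k).1.2) / (B : ℤ)) := zero_sub _
    rw [h₂, abs_neg]
    exact h₁.trans (by exact_mod_cast (by omega : W ≤ H))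
  have hpot : potential A (fun _ => 0) (n + m) ≤ n + m + (M / B + 1) * (n + 4 * m) :=
    potential_zero_le A (n + m)
  have hpot' : (M / B + 1) * (n + 4 * m) ≤ (M + 1) * (n + 4 * m) :=
    Nat.mul_le_mul_right _ (by omega)
  have hround : ∀ u v, GameGraph.roundUp B w u v = (0 - (0 - w u v) / B) * B :=
    GameGraph.roundUp_eq B w
  have key := halts_solveArena hN (fun k => (hw k).trans (by exact_mod_cast (by omega : W ≤ H)))
    (by omega : B ≤ H) (fun _ => rfl)
    (fun x hx => by
      have h₁ : x * B ≤ M / B * B := Nat.mul_le_mul_right B (by omega)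
      have h₂ := Nat.div_mul_le_self M B
      omega)
    -- The property preserved by lifts is being a lower bound for the sufficient energies.
    (by omega) (P := Arena.IsLowerBound G (GameGraph.roundUp B w) B (M / B + 1))
    Arena.isLowerBound_zero (fun f x hf hx => hf.lift edges hB hround hM hx)
    (setup_inputStore (c := c) B)
  have h0 : (inputStore G w edges M c).reg 0 = n := rfl
  have h2 : (inputStore G w edges M c).reg 2 = M := rfl
  have h3 : (inputStore G w edges M c).reg 3 = c := rfl
  have hdivcast : (c : ℤ) / n = B := by rw [hBdef]; norm_cast
  refine Halts.assign_seq B ?_ ?_ (by simp [Expr.cost]) ?_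
  · simp only [Expr.Fits, Expr.eval, Op.eval, h0, h3, hdivcast, abs_le]
    omega
  · simp only [Expr.eval, Op.eval, h0, h3, hdivcast]
  refine Halts.assign_seq (M / B + 1 : ℕ) ?_ ?_ (by simp only [Expr.cost]; omega) ?_
  · have : ((M : ℤ) / B) = (M / B : ℕ) := by norm_cast
    simp only [Expr.Fits, Expr.eval, Op.eval, Store.reg_setReg, Nat.reduceEqDiff, if_true, if_false,
      h2, this, abs_le]
    omega
  · simp [Expr.eval, Op.eval, h2]
  refine key.mono (by simp only [Expr.cost]; omega) ?_
  rintro s ⟨f, hf, hsl, hout⟩ v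
  simp only [hout, Arena.minEnergy_eq edges hround hB hf hsl v]
  simp only [htopdef]
  split_ifs
  · rw [← Nat.cast_mul]
    rfl
  · rfl

theorem time_le (hn : 0 < n) (hnm : n ≤ m) (hc : n ≤ c) :
    ((400 * (n + m + (M / (c / n) + 1) * (n + 4 * m)) + 420 : ℕ) : ℝ) ≤
      -- Since `c / n ≥ 1`, rounding down loses at most a factor `2`, so `M / B ≤ 2 μ`. With `n ≤ m`
      -- the total is at most `(400 * (2 + 15) + 420) * m * μ`, and `8000` suffices.
      8000 * m * max 1 ((n : ℝ) * M / c) := by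
  have hB : 0 < c / n := Nat.div_pos hc hn
  have hcB : c ≤ 2 * n * (c / n) := by
    have h₁ := Nat.lt_mul_div_succ c hn
    have h₂ : n * (c / n + 1) ≤ n * (2 * (c / n)) := Nat.mul_le_mul_left n (by omega)
    have h₃ : n * (2 * (c / n)) = 2 * n * (c / n) := by ring
    omega
  obtain ⟨B, hBdef⟩ : ∃ B, B = c / n := ⟨_, rfl⟩
  rw [← hBdef] at hB hcB ⊢
  set μ := max 1 ((n : ℝ) * M / c) with hμ
  have hμ₁ : 1 ≤ μ := le_max_left _ _
  have hμ₂ : (n : ℝ) * M / c ≤ μ := le_max_right _ _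
  have hBr : (0 : ℝ) < B := by exact_mod_cast hB
  have hcr : (0 : ℝ) < c := by exact_mod_cast hn.trans_le hc
  have hcBr : (c : ℝ) ≤ 2 * n * B := by exact_mod_cast hcB
  have hT : ((M / B : ℕ) : ℝ) ≤ 2 * μ := by
    have h₁ : (M : ℝ) / B ≤ 2 * (n * M / c) := by
      rw [← mul_div_assoc, div_le_div_iff₀ hBr hcr]
      nlinarith [Nat.cast_nonneg (α := ℝ) M]
    exact Nat.cast_div_le.trans (h₁.trans (by linarith))
  have hnr : (n : ℝ) ≤ m := by exact_mod_cast hnm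
  have hmr : (1 : ℝ) ≤ m := by exact_mod_cast hn.trans_le hnm
  push_cast
  have h₁ : (((M / B : ℕ) : ℝ) + 1) * (n + 4 * m) ≤ 3 * μ * (5 * m) :=
    mul_le_mul (by linarith) (by linarith) (by positivity) (by positivity)
  have h₂ : (m : ℝ) ≤ m * μ := le_mul_of_one_le_right (by linarith) hμ₁
  nlinarith

end RAM

end

theorem theorem2 :
    ∃ (prog : RAM.Program) (C K : ℕ),
      ∀ (n m : ℕ) (G : GameGraph (Fin n)) (w : Fin n → Fin n → ℤ) (edges : Fin m ≃ G.Edge)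
        (M c : ℕ),
        0 < n →
        1 ≤ G.penalty w →
        n ≤ c →
        (c : ENNReal) ≤ (n : ENNReal) * G.penalty w →
        G.IsFiniteEnergyBound w M →
        ∃ (e : Fin n → ℕ∞) (t : ℕ) (s : RAM.Store),
          RAM.Runs ((n + M + c + RAM.maxWeight G w edges + 2) ^ K) prog
            (RAM.inputStore G w edges M c) t s ∧
          (t : ℝ) ≤ (C : ℝ) * (m : ℝ) * max 1 ((n : ℝ) * (M : ℝ) / (c : ℝ)) ∧
          RAM.Outputs s e ∧
          (∀ v, e v = G.minEnergy (GameGraph.roundUp (c / n) w) v) ∧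
          (∀ v, e v ≤ G.minEnergy w v ∧ G.minEnergy w v ≤ e v + (c : ℕ∞)) := by
  refine ⟨RAM.solve, 8000, 6, fun n m G w edges M c hn _ hc hpen hM => ?_⟩
  have hB : 0 < c / n := Nat.div_pos hc hn
  have hle : ∀ v, G.minEnergy (GameGraph.roundUp (c / n) w) v ≤ G.minEnergy w v :=
    GameGraph.minEnergy_mono (GameGraph.le_roundUp hB w)
  have hge : ∀ v, G.minEnergy w v ≤ G.minEnergy (GameGraph.roundUp (c / n) w) v + (c : ℕ∞) := by
    intro v
    have hn' : (n : ℝ≥0∞) ≠ 0 := by exact_mod_cast hn.ne'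
    refine GameGraph.minEnergy_le_roundUp_add hB
      (by simpa using Nat.mul_div_le c n) (le_trans ?_ (iInf_le _ v))
    -- Multiplied by `n`, the claim follows from `n * (c / n) ≤ c` and the upper bound on `c`.
    rw [← ENNReal.mul_le_mul_iff_right hn' (ENNReal.natCast_ne_top n)]
    refine le_trans ?_ hpen
    exact_mod_cast Nat.mul_div_le c n
  -- A finite rounded energy forces a finite original one, at most `M`, which in turn bounds the
  -- rounded one.
  have hM' : G.IsFiniteEnergyBound (GameGraph.roundUp (c / n) w) M := fun v hv =>
    (hle v).trans (hM v (ne_top_of_le_ne_top (by simpa using hv) (hge v)))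
  obtain ⟨t, s, hrun, ht, hout⟩ := RAM.halts_solve (edges := edges) hn hc hM'
  refine ⟨_, t, s, hrun, ?_, hout, fun _ => rfl, fun v => ⟨hle v, hge v⟩⟩
  have ht' : (t : ℝ) ≤ _ := Nat.cast_le.mpr ht
  refine ht'.trans ?_
  exact_mod_cast RAM.time_le (M := M) hn (GameGraph.card_nodes_le edges) hc
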